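/- Let $n=2m$ be even, let $V$ be a real symmetric positive definite circulant $n\times n$ matrix ($V_{jk}=v_{(j-k)\bmod n}$), and consider a ring of $n$ harmonic oscillators with Hamiltonian (units $\hbar=m_{\rm osc}=\omega=1$) $$\hat H=\tfrac12\sum_{j=1}^n \hat P_j^2+\tfrac12\sum_{j,k=1}^n V_{jk}\hat X_j\hat X_k .$$ Split the ring into the two contiguous halves $\{1,\dots,m\}$ and $\{m+1,\dots,n\}$. Let $F$ be the flip matrix, $F_{ij}=\delta_{i,n+1-j}$ (and likewise of size $m$), and let $V''$ be the upper right $m\times m$ block of $V$. For a state with covariance matrix $\gamma_{kl}=\mathrm{Re}\,\langle (R_k-\langle R_k\rangle)(R_l-\langle R_l\rangle)\rangle$, $R=(\hat X_1,\dots,\hat X_n,\hat P_1,\dots,\hat P_n)$, let $\gamma^\Gamma$ be obtained from $\gamma$ by reversing the sign of the momenta of the second half, let $\Sigma=\begin{pmatrix}0&1_n\\-1_n&0\end{pmatrix}$, and define the logarithmic negativity by $$N=-\sum_{k=1}^{2n}\log_2\min\bigl(1,\,2|\lambda_k(i\Sigma^{-1}\gamma^\Gamma)|\bigr),$$ where the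 sum runs over all $2n$ eigenvalues, with multiplicity. Then $\hat H$ has a ground state, and every ground state $\psi$ satisfies the following. 1. The partial transpose $(|\psi\rangle\langle\psi|)^\Gamma$ with respect to the second half has finite trace norm, and $N=2\log_2\bigl\|(|\psi\rangle\langle\psi|)^\Gamma\bigr\|_1$. (So, in this normalization, $N$ is twice the base-2 logarithm of the trace norm.) 2. $N\ge \tfrac12\bigl|\mathrm{Tr}[F\log_2 V]\bigr|$. 3. If $V''F$ is positive semidefinite or negative semidefinite, then $N=\tfrac12\bigl|\mathrm{Tr}[F\log_2 V]\bigr|$. 4. If the coupling is nearest-neighbour ($V_{jk}=0$ unless $j=k$ or $j,k$ are adjacent on the ring), then $V''F$ is semidefinite, and hence $N=\tfrac12\bigl|\mathrm{Tr}[F\log_2 V]\bigr|$. -/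

import Mathlib

open scoped ENNReal ComplexConjugate SchwartzMap

noncomputable section

namespace HarmonicChain

/-! ### Matrices -/

/-- A real `n × n` matrix is circulant if `V j k = v ((j - k) mod n)`; subtraction in `Fin n` is
subtraction modulo `n`. -/
def IsCirculant {n : ℕ} (V : Matrix (Fin n) (Fin n) ℝ) : Prop :=
  ∃ v : Fin n → ℝ, V = Matrix.circulant v

/-- The flip matrix `F`, with ones on the anti-diagonal and zeros elsewhere. -/
def flip (n : ℕ) : Matrix (Fin n) (Fin n) ℝ :=
  Matrix.of fun i j => if i = Fin.rev j then 1 else 0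

/-- The base-two logarithm of a symmetric real matrix (functional calculus). -/
def matrixLog2 {n : ℕ} (V : Matrix (Fin n) (Fin n) ℝ) : Matrix (Fin n) (Fin n) ℝ :=
  cfc (Real.logb 2) V

/-- The upper right `m × m` block `V''` of a `2m × 2m` matrix. -/
def offDiagBlock {m : ℕ} (V : Matrix (Fin (m + m)) (Fin (m + m)) ℝ) :
    Matrix (Fin m) (Fin m) ℝ :=
  V.submatrix (Fin.castAdd m) (Fin.natAdd m)

/-- Positive or negative semidefinite. -/
def IsSemidefinite {m : ℕ} (A : Matrix (Fin m) (Fin m) ℝ) : Prop :=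
  A.PosSemidef ∨ (-A).PosSemidef

/-- Only neighbouring oscillators on the ring are coupled. -/
def IsNearestNeighbour {n : ℕ} (V : Matrix (Fin n) (Fin n) ℝ) : Prop :=
  ∀ i j : Fin n, V i j ≠ 0 →
    i = j ∨ (i.val + 1) % n = j.val ∨ (j.val + 1) % n = i.val

/-! ### The oscillators and their ground state (units with `ħ = m = ω = 1`) -/

/-- The quadrature operators `R` of `n` oscillators in the Schrödinger representation:
`Sum.inl j` is the position operator `X_j`, multiplication by `x_j`, and `Sum.inr j` is the
momentum operator `P_j = -i ∂/∂x_j`. -/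
def quadrature {n : ℕ} : Fin n ⊕ Fin n → ((Fin n → ℝ) → ℂ) → (Fin n → ℝ) → ℂ
  | Sum.inl j => fun ψ x => (x j : ℂ) * ψ x
  | Sum.inr j => fun ψ x => -Complex.I * fderiv ℝ ψ x (Pi.single j 1)

/-- The Hamiltonian matrix `V/2 ⊕ 1/2`. -/
def hamiltonianMatrix {n : ℕ} (V : Matrix (Fin n) (Fin n) ℝ) :
    Matrix (Fin n ⊕ Fin n) (Fin n ⊕ Fin n) ℝ :=
  Matrix.fromBlocks ((1 / 2 : ℝ) • V) 0 0 ((1 / 2 : ℝ) • 1)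

/-- The Hamiltonian operator `H = Rᵀ (V/2 ⊕ 1/2) R`. -/
def hamiltonian {n : ℕ} (V : Matrix (Fin n) (Fin n) ℝ) (ψ : (Fin n → ℝ) → ℂ) :
    (Fin n → ℝ) → ℂ :=
  fun x => ∑ k, ∑ l, (hamiltonianMatrix V k l : ℂ) * quadrature k (quadrature l ψ) x

/-- `⟨ψ, A ψ⟩` in `L²(ℝⁿ)`. -/
def expectation {n : ℕ} (ψ : (Fin n → ℝ) → ℂ)
    (A : ((Fin n → ℝ) → ℂ) → (Fin n → ℝ) → ℂ) : ℂ :=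
  ∫ x, conj (ψ x) * A ψ x

/-- The wave function `ψ` is a ground state: it has norm one and is an eigenfunction of the
Hamiltonian whose eigenvalue `E` is the minimum of the energy. The Hamiltonian acts on the Schwartz
space, which is a core of it. -/
def IsGroundState {n : ℕ} (V : Matrix (Fin n) (Fin n) ℝ) (ψ : 𝓢(Fin n → ℝ, ℂ)) : Prop :=
  ∫ x, ‖ψ x‖ ^ 2 = 1 ∧
  ∃ E : ℝ, (∀ x, hamiltonian V ψ x = E * ψ x) ∧
    ∀ φ : 𝓢(Fin n → ℝ, ℂ), ∫ x, ‖φ x‖ ^ 2 = 1 → E ≤ (expectation φ (hamiltonian V)).re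

/-! ### The covariance matrix and the entanglement formula in terms of it -/

/-- `R_k` minus its mean in the state `ψ`. -/
def centeredQuadrature {n : ℕ} (ψ : (Fin n → ℝ) → ℂ) (k : Fin n ⊕ Fin n)
    (φ : (Fin n → ℝ) → ℂ) : (Fin n → ℝ) → ℂ :=
  fun x => quadrature k φ x - expectation ψ (quadrature k) * φ x

/-- The covariance matrix `γ_{kl} = Re ⟨ψ, (R_k - ⟨R_k⟩) (R_l - ⟨R_l⟩) ψ⟩`. -/
def covarianceMatrix {n : ℕ} (ψ : (Fin n → ℝ) → ℂ) :
    Matrix (Fin n ⊕ Fin n) (Fin n ⊕ Fin n) ℝ :=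
  Matrix.of fun k l =>
    (expectation ψ fun φ => centeredQuadrature ψ k (centeredQuadrature ψ l φ)).re

/-- The symplectic matrix. -/
def symplecticMatrix (n : ℕ) : Matrix (Fin n ⊕ Fin n) (Fin n ⊕ Fin n) ℝ :=
  Matrix.fromBlocks 0 1 (-1) 0

/-- The matrix `P = 1 ⊕ P_p`, which changes the sign of the momenta of the second group, the
oscillators `m, …, 2m - 1`. -/
def momentumReversal (m : ℕ) :
    Matrix (Fin (m + m) ⊕ Fin (m + m)) (Fin (m + m) ⊕ Fin (m + m)) ℝ :=
  Matrix.fromBlocks 1 0 0 (Matrix.diagonal fun i => if i.val < m then 1 else -1)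

/-- `i Σ⁻¹ P γ P`, with `P γ P` the partial transpose of the covariance matrix `γ`. -/
def negativityMatrix {m : ℕ}
    (γ : Matrix (Fin (m + m) ⊕ Fin (m + m)) (Fin (m + m) ⊕ Fin (m + m)) ℝ) :
    Matrix (Fin (m + m) ⊕ Fin (m + m)) (Fin (m + m) ⊕ Fin (m + m)) ℂ :=
  Complex.I • ((symplecticMatrix (m + m))⁻¹ *
    (momentumReversal m * γ * momentumReversal m)).map Complex.ofReal

/-- `N = - ∑ₖ log₂ (min (1, 2 |λₖ|))`, the sum over all `4m` eigenvalues of `i Σ⁻¹ P γ P`, with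
multiplicity. -/
def negativitySum {m : ℕ}
    (γ : Matrix (Fin (m + m) ⊕ Fin (m + m)) (Fin (m + m) ⊕ Fin (m + m)) ℝ) : ℝ :=
  -((negativityMatrix γ).charpoly.roots.map fun z => Real.logb 2 (min 1 (2 * ‖z‖))).sum

/-! ### The trace norm of the partial transpose of the state -/

/-- The integral kernel `ρ(x, y) = ψ(x) conj ψ(y)` of the density operator `|ψ⟩⟨ψ|`. -/
def densityKernel {n : ℕ} (ψ : (Fin n → ℝ) → ℂ) : (Fin n → ℝ) → (Fin n → ℝ) → ℂ :=
  fun x y => ψ x * conj (ψ y)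

/-- The configuration in which the oscillators of the first group (`0, …, m - 1`) are as in `x`
and those of the second group are as in `y`. -/
def glue {m : ℕ} (x y : Fin (m + m) → ℝ) : Fin (m + m) → ℝ :=
  fun i => if i.val < m then x i else y i

/-- Partial transposition in the second group, on kernels:
`ρ^Γ((a, b), (a', b')) = ρ((a, b'), (a', b))`. -/
def partialTranspose {m : ℕ} (ρ : (Fin (m + m) → ℝ) → (Fin (m + m) → ℝ) → ℂ) :
    (Fin (m + m) → ℝ) → (Fin (m + m) → ℝ) → ℂ :=
  fun x y => ρ (glue x y) (glue y x)

/-- The trace norm of the operator `T` on `L²(ℝⁿ)` with integral kernel `κ`: the supremum of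
`∑ᵢ |⟨eᵢ, T fᵢ⟩|` over finite orthonormal families `e` and `f`. -/
def traceNorm {n : ℕ} (κ : (Fin n → ℝ) → (Fin n → ℝ) → ℂ) : ℝ≥0∞ :=
  ⨆ (r : ℕ) (e : Fin r → MeasureTheory.Lp ℂ 2 (MeasureTheory.volume : MeasureTheory.Measure (Fin n → ℝ)))
    (f : Fin r → MeasureTheory.Lp ℂ 2 (MeasureTheory.volume : MeasureTheory.Measure (Fin n → ℝ)))
    (_ : Orthonormal ℂ e) (_ : Orthonormal ℂ f),
    ∑ i, ‖∫ x, conj (e i x) * ∫ y, κ x y * f i y‖ₑ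

end HarmonicChain

end

/-! Let `S = √V`. Then `H = ½ ∑ aⱼ* aⱼ + ½ Tr S` with `aⱼ = ∂ⱼ + (S x)ⱼ`, so the ground states are
exactly the normalized solutions of `aⱼ ψ = 0`, that is, multiples of `exp (-⟨x, S x⟩ / 2)`. Their
covariance matrix is `½ (S⁻¹ ⊕ S)`, and the partial transposition replaces the momentum block `S` by
`P S P`, where `P` is the sign of the half (`halfSign`).

A symmetric circulant `V` commutes with the flip. On even and odd vectors `S` has blocks `A` and
`B`, with `A² - B² = 2 V''F`, while `P` exchanges the two parities; so `P S P` has blocks `B` and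
`A`. A congruence `K` with `Kᵀ A K = 1`, `Kᵀ B K = diag ν` gives one basis in which `S` has entries
`(1, ν)` and `P S P` has `(ν, 1)` (`exists_normalForm`). For entries `s`, `t` the partially
transposed spectrum is `±½ √(t/s)`, so `N = ∑ max(0, log₂ (s/t)) = ∑ |log₂ νⱼ|`
(`negativitySum_eq`). Determinants give `Tr[F log₂ V] = 2 log₂ (det A / det B) = -2 ∑ log₂ νⱼ`. The
lower bound is therefore the triangle inequality, with equality if all `log₂ νⱼ` have one sign;
semidefiniteness of `A² - B²` forces this (`le_one_of_posSemidef_sq_sub_sq`).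

For the trace norm, the transposed kernel in the same coordinates is a product of factors `exp (-d
(u² + v²)/2 - b u v)` with `d = (s+t)/2`, `b = (s-t)/2`. Expanding `exp (-b u v)` makes it a sum of
signed rank one kernels, and a reflection implements all the signs at once. So the trace norm is the
sum of the squared norms (`traceNorm_eq_tsum`), a Gaussian integral with exponents `d - |b| = min(s,
t)` (`traceNorm_mehler`). -/

namespace HarmonicChain

open Matrix

/-! ### Diagonalization of real symmetric matrices and functional calculus -/

section Spectral

variable {ι : Type*} [Fintype ι] [DecidableEq ι]

theorem exists_orthogonal_diagonalization {A : Matrix ι ι ℝ} (hA : A.IsSymm) :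
    ∃ (U : Matrix ι ι ℝ) (d : ι → ℝ), Uᵀ * U = 1 ∧ U * Uᵀ = 1 ∧ A = U * diagonal d * Uᵀ := by
  have hA' : A.IsHermitian := by
    rw [IsHermitian, conjTranspose_eq_transpose_of_trivial]; exact hA
  refine ⟨hA'.eigenvectorUnitary, hA'.eigenvalues, ?_, ?_, ?_⟩
  · have := Unitary.coe_star_mul_self hA'.eigenvectorUnitary
    rwa [star_eq_conjTranspose, conjTranspose_eq_transpose_of_trivial] at this
  · have := Unitary.coe_mul_star_self hA'.eigenvectorUnitary
    rwa [Unitary.coe_star, star_eq_conjTranspose, conjTranspose_eq_transpose_of_trivial] at this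
  · have := hA'.spectral_theorem
    rw [Unitary.conjStarAlgAut_apply, star_eq_conjTranspose,
      conjTranspose_eq_transpose_of_trivial] at this
    exact this

theorem isSymm_conj_diagonal (U : Matrix ι ι ℝ) (d : ι → ℝ) :
    (U * diagonal d * Uᵀ).IsSymm := by
  simp [Matrix.IsSymm, transpose_mul, Matrix.mul_assoc]

theorem pow_conj_diagonal {U : Matrix ι ι ℝ} (hU : Uᵀ * U = 1) (hU' : U * Uᵀ = 1) (d : ι → ℝ)
    (k : ℕ) : (U * diagonal d * Uᵀ) ^ k = U * diagonal (d ^ k) * Uᵀ := by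
  induction k with
  | zero => simp [hU']
  | succ k ih =>
    rw [pow_succ, ih]
    calc _ = U * diagonal (d ^ k) * (Uᵀ * U) * diagonal d * Uᵀ := by
          simp only [Matrix.mul_assoc]
      _ = _ := by
          rw [hU, Matrix.mul_one, Matrix.mul_assoc U, diagonal_mul_diagonal]
          rfl

theorem aeval_conj_diagonal {U : Matrix ι ι ℝ} (hU : Uᵀ * U = 1) (hU' : U * Uᵀ = 1) (d : ι → ℝ)
    (p : Polynomial ℝ) :
    Polynomial.aeval (U * diagonal d * Uᵀ) p = U * diagonal (fun i => p.eval (d i)) * Uᵀ := by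
  induction p using Polynomial.induction_on' with
  | add p q hp hq =>
    simp only [map_add, hp, hq, Polynomial.eval_add]
    rw [← diagonal_add, Matrix.mul_add, Matrix.add_mul]
  | monomial k a =>
    rw [Polynomial.aeval_monomial, pow_conj_diagonal hU hU', ← Algebra.smul_def]
    simp only [Polynomial.eval_monomial]
    have : diagonal (fun i => a * d i ^ k) = a • diagonal (d ^ k) := by
      ext i j; by_cases h : i = j <;> simp [h]
    rw [this, Matrix.mul_smul, Matrix.smul_mul]

/-- The spectrum lies in the finite set of the `d i`, where `f` agrees with a Lagrange interpolation
polynomial. Hence the polynomial case suffices and `f` may be arbitrary. -/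
theorem cfc_conj_diagonal {U : Matrix ι ι ℝ} (hU : Uᵀ * U = 1) (hU' : U * Uᵀ = 1) (d : ι → ℝ)
    (f : ℝ → ℝ) :
    cfc f (U * diagonal d * Uᵀ) = U * diagonal (fun i => f (d i)) * Uᵀ := by
  have hsymm : IsSelfAdjoint (U * diagonal d * Uᵀ) := by
    rw [IsSelfAdjoint, star_eq_conjTranspose, conjTranspose_eq_transpose_of_trivial]
    exact isSymm_conj_diagonal U d
  let s : Finset ℝ := Finset.univ.image d
  let p : Polynomial ℝ := Lagrange.interpolate s id f
  have hp : ∀ i, p.eval (d i) = f (d i) := fun i =>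
    Lagrange.eval_interpolate_at_node (v := id) f (Set.injOn_id _)
      (Finset.mem_image_of_mem d (Finset.mem_univ i))
  have hspec : spectrum ℝ (U * diagonal d * Uᵀ) ⊆ Set.range d := by
    have hmem : U ∈ unitary (Matrix ι ι ℝ) := by
      rw [Unitary.mem_iff, star_eq_conjTranspose, conjTranspose_eq_transpose_of_trivial]
      exact ⟨hU, hU'⟩
    have := Unitary.spectrum_star_right_conjugate (R := ℝ) (a := diagonal d) (U := ⟨U, hmem⟩)
    simp only [star_eq_conjTranspose, conjTranspose_eq_transpose_of_trivial] at this
    rw [this, spectrum_diagonal]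
  have h1 : cfc f (U * diagonal d * Uᵀ) = cfc p.eval (U * diagonal d * Uᵀ) := by
    apply cfc_congr
    intro x hx
    obtain ⟨i, rfl⟩ := hspec hx
    exact (hp i).symm
  rw [h1, cfc_polynomial p _ hsymm, aeval_conj_diagonal hU hU']
  simp [hp]

theorem conj_diagonal_pos {A U : Matrix ι ι ℝ} (hA : A.PosDef) (hU : Uᵀ * U = 1) {d : ι → ℝ}
    (h : A = U * diagonal d * Uᵀ) (i : ι) : 0 < d i := by
  have hinj : Function.Injective U.mulVec := by
    intro x y hxy
    have := congrArg (Uᵀ.mulVec) hxy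
    simpa [hU] using this
  have h2 := hA.conjTranspose_mul_mul_same hinj
  rw [conjTranspose_eq_transpose_of_trivial, h] at h2
  have h3 : Uᵀ * (U * diagonal d * Uᵀ) * U = diagonal d := by
    calc _ = (Uᵀ * U) * diagonal d * (Uᵀ * U) := by simp only [Matrix.mul_assoc]
      _ = _ := by simp [hU]
  rw [h3] at h2
  exact posDef_diagonal_iff.1 h2 i

theorem posDef_conj_diagonal {U : Matrix ι ι ℝ} (hU : U * Uᵀ = 1) {d : ι → ℝ}
    (hd : ∀ i, 0 < d i) : (U * diagonal d * Uᵀ).PosDef := by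
  have hinj : Function.Injective U.vecMul := by
    intro x y hxy
    have := congrArg (Uᵀ.vecMul) hxy
    simpa [Matrix.vecMul_vecMul, hU] using this
  have := (PosDef.diagonal hd).mul_mul_conjTranspose_same hinj
  rwa [conjTranspose_eq_transpose_of_trivial] at this

/-- First normalize `A` to the identity by `G = U a^(-1/2)`; then an orthogonal `W` diagonalizes `Gᵀ
B G` and preserves the identity. -/
theorem exists_simultaneous_diagonalization {A B : Matrix ι ι ℝ} (hA : A.PosDef) (hB : B.IsSymm) :
    ∃ (K : Matrix ι ι ℝ) (ν : ι → ℝ), Kᵀ * A * K = 1 ∧ Kᵀ * B * K = diagonal ν := by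
  have hA' : A.IsSymm := by
    have := hA.1
    rwa [IsHermitian, conjTranspose_eq_transpose_of_trivial] at this
  obtain ⟨U, a, hU, hU', rfl⟩ := exists_orthogonal_diagonalization hA'
  have ha := conj_diagonal_pos hA hU rfl
  set G : Matrix ι ι ℝ := U * diagonal (fun i => (√(a i))⁻¹) with hG
  have hGA : Gᵀ * (U * diagonal a * Uᵀ) * G = 1 := by
    calc _ = diagonal (fun i => (√(a i))⁻¹) * (Uᵀ * U) * diagonal a * (Uᵀ * U) *
          diagonal (fun i => (√(a i))⁻¹) := by
          simp only [hG, transpose_mul, diagonal_transpose, Matrix.mul_assoc]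
      _ = 1 := by
          simp only [hU, Matrix.mul_one, diagonal_mul_diagonal]
          rw [← diagonal_one]
          congr 1
          ext i
          have h1 : √(a i) ≠ 0 := (Real.sqrt_pos.2 (ha i)).ne'
          have h2 := Real.mul_self_sqrt (ha i).le
          field_simp
          rw [sq, h2]
  have hsym : (Gᵀ * B * G).IsSymm := by
    simp [Matrix.IsSymm, transpose_mul, Matrix.mul_assoc, hB.eq]
  obtain ⟨W, ν, hW, hW', hWB⟩ := exists_orthogonal_diagonalization hsym
  refine ⟨G * W, ν, ?_, ?_⟩
  · calc _ = Wᵀ * (Gᵀ * (U * diagonal a * Uᵀ) * G) * W := by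
          simp only [transpose_mul, Matrix.mul_assoc]
      _ = 1 := by rw [hGA, Matrix.mul_one, hW]
  · calc _ = Wᵀ * (Gᵀ * B * G) * W := by simp only [transpose_mul, Matrix.mul_assoc]
      _ = (Wᵀ * W) * diagonal ν * (Wᵀ * W) := by rw [hWB]; simp only [Matrix.mul_assoc]
      _ = _ := by simp [hW]

end Spectral

end HarmonicChain

/-! ### The flip and circulant matrices -/

namespace HarmonicChain

open Matrix

theorem flip_mul_self (m : ℕ) : flip m * flip m = 1 := by
  ext i j
  simp only [flip, mul_apply, of_apply, mul_ite, mul_one, mul_zero, one_apply]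
  rw [Finset.sum_eq_single (Fin.rev j)]
  · simp
  · intro b _ hb; simp [hb]
  · simp

theorem flip_transpose (m : ℕ) : (flip m)ᵀ = flip m := by
  ext i j
  simp only [flip, transpose_apply, of_apply]
  congr 1
  rw [eq_iff_iff]
  constructor <;> rintro rfl <;> simp

theorem mul_flip_apply {m : ℕ} {κ : Type*} (A : Matrix κ (Fin m) ℝ) (i : κ) (j : Fin m) :
    (A * flip m) i j = A i (Fin.rev j) := by
  simp [flip, mul_apply]

theorem flip_mul_apply {m : ℕ} {κ : Type*} (A : Matrix (Fin m) κ ℝ) (i : Fin m) (j : κ) :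
    (flip m * A) i j = A (Fin.rev i) j := by
  have : ∀ k, (i = Fin.rev k) = (k = Fin.rev i) := by
    intro k; rw [eq_iff_iff]; constructor <;> rintro rfl <;> simp
  simp [flip, mul_apply, this]

/-- Reversal turns the difference `i - j` into `j - i`, which symmetry undoes. This is the
commutation of `V` with the flip. -/
theorem IsCirculant.rev_rev {n : ℕ} {V : Matrix (Fin n) (Fin n) ℝ} (h : IsCirculant V)
    (hs : V.IsSymm) (i j : Fin n) : V (Fin.rev i) (Fin.rev j) = V i j := by
  rw [← hs.apply i j]
  obtain ⟨v, rfl⟩ := h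
  simp only [circulant_apply]
  congr 1
  ext
  simp only [Fin.sub_def, Fin.val_rev]
  congr 1
  omega

theorem IsCirculant.apply_eq_of_add_eq {n : ℕ} {V : Matrix (Fin n) (Fin n) ℝ} (h : IsCirculant V)
    {i j k l : Fin n} (hij : (n - j.val + i.val) % n = (n - l.val + k.val) % n) :
    V i j = V k l := by
  obtain ⟨v, rfl⟩ := h
  simp only [circulant_apply]
  congr 1
  ext
  simpa only [Fin.sub_def] using hij

/-- Only two bonds cross the cut, `(m-1, m)` and `(0, 2m-1)`. The flip moves both to the ends of the
diagonal, and circulance gives them the same strength `c`, whose sign decides. -/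
theorem isSemidefinite_of_isNearestNeighbour {m : ℕ} {V : Matrix (Fin (m + m)) (Fin (m + m)) ℝ}
    (h : IsCirculant V) (hs : V.IsSymm) (hn : IsNearestNeighbour V) :
    IsSemidefinite (offDiagBlock V * flip m) := by
  have hentry : ∀ i j, (offDiagBlock V * flip m) i j =
      V (Fin.castAdd m i) (Fin.natAdd m (Fin.rev j)) := by
    intro i j; rw [mul_flip_apply]; rfl
  have hzero : ∀ i j, (offDiagBlock V * flip m) i j ≠ 0 →
      i = j ∧ (i.val = 0 ∨ i.val = m - 1) := by
    intro i j hij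
    rw [hentry] at hij
    have hi := i.2
    have hj := j.2
    rcases hn _ _ hij with h1 | h1 | h1
    · have := congrArg Fin.val h1
      simp at this
      omega
    · simp only [Fin.val_castAdd, Fin.val_natAdd, Fin.val_rev] at h1
      rw [Nat.mod_eq_of_lt (by omega)] at h1
      refine ⟨Fin.ext (by omega), by omega⟩
    · simp only [Fin.val_castAdd, Fin.val_natAdd, Fin.val_rev] at h1
      rcases Nat.lt_or_ge (m + (m - (j.val + 1)) + 1) (m + m) with h2 | h2
      · rw [Nat.mod_eq_of_lt h2] at h1; omega
      · have h3 : m + (m - (j.val + 1)) + 1 = m + m := by omega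
        rw [h3, Nat.mod_self] at h1
        refine ⟨Fin.ext (by omega), by omega⟩
  have hconst : ∃ c : ℝ, ∀ i : Fin m, (i.val = 0 ∨ i.val = m - 1) →
      (offDiagBlock V * flip m) i i = c := by
    rcases Nat.eq_zero_or_pos m with rfl | hm
    · exact ⟨0, fun i => i.elim0⟩
    · refine ⟨V ⟨0, by omega⟩ ⟨m + m - 1, by omega⟩, ?_⟩
      intro i hi
      rw [hentry]
      rcases hi with hi | hi
      · congr 1
        · ext; simp [hi]
        · ext; simp [hi]; omega
      -- After transposition the entry is at `(m, m-1)`, with the same difference `1` modulo `2m` as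
      -- `(0, 2m-1)`.
      · rw [← hs.apply]
        apply h.apply_eq_of_add_eq
        simp only [Fin.val_castAdd, Fin.val_natAdd, Fin.val_rev, hi]
        rw [show m + m - (m - 1) + (m + (m - (m - 1 + 1))) = 1 + (m + m) by omega,
          Nat.add_mod_right]
        congr 1
        omega
  obtain ⟨c, hc⟩ := hconst
  have hdiag : offDiagBlock V * flip m =
      diagonal fun i => (offDiagBlock V * flip m) i i := by
    ext i j
    by_cases hij : i = j
    · subst hij; simp
    · rw [diagonal_apply_ne _ hij]
      by_contra h0
      exact hij (hzero i j h0).1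
  rcases le_total 0 c with h0 | h0
  · left
    rw [hdiag]
    apply PosSemidef.diagonal
    intro i
    by_cases hi : (offDiagBlock V * flip m) i i = 0
    · simp [hi]
    · simp only [Pi.zero_apply]
      rw [hc i (hzero i i hi).2]; exact h0
  · right
    rw [hdiag, diagonal_neg]
    apply PosSemidef.diagonal
    intro i
    by_cases hi : (offDiagBlock V * flip m) i i = 0
    · simp [hi]
    · simp only [Pi.zero_apply, Left.nonneg_neg_iff]
      rw [hc i (hzero i i hi).2]; exact h0

end HarmonicChain

/-! ### Block diagonalization by parity -/

namespace HarmonicChain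

open Matrix

/-- The orthogonal change of basis to vectors that are even or odd under the flip. -/
noncomputable def parityBasis (m : ℕ) : Matrix (Fin m ⊕ Fin m) (Fin m ⊕ Fin m) ℝ :=
  (√2)⁻¹ • fromBlocks 1 1 (flip m) (-flip m)

theorem parityBasis_transpose (m : ℕ) :
    (parityBasis m)ᵀ = (√2)⁻¹ • fromBlocks 1 (flip m) 1 (-flip m) := by
  simp [parityBasis, fromBlocks_transpose, flip_transpose]

theorem parityBasis_transpose_mul_fromBlocks_mul {m : ℕ} (A B C D : Matrix (Fin m) (Fin m) ℝ) :
    (parityBasis m)ᵀ * fromBlocks A B C D * parityBasis m =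
      (1 / 2 : ℝ) • fromBlocks
        (A + B * flip m + flip m * C + flip m * D * flip m)
        (A - B * flip m + flip m * C - flip m * D * flip m)
        (A + B * flip m - flip m * C - flip m * D * flip m)
        (A - B * flip m - flip m * C + flip m * D * flip m) := by
  rw [parityBasis_transpose, parityBasis, Matrix.smul_mul, Matrix.mul_smul, Matrix.smul_mul,
    smul_smul, ← mul_inv, Real.mul_self_sqrt (by norm_num), fromBlocks_multiply,
    fromBlocks_multiply, one_div]
  congr 2 <;> simp only [Matrix.one_mul, Matrix.mul_one, Matrix.add_mul, Matrix.mul_neg,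
    Matrix.neg_mul] <;> abel

theorem parityBasis_transpose_mul_self (m : ℕ) : (parityBasis m)ᵀ * parityBasis m = 1 := by
  have := parityBasis_transpose_mul_fromBlocks_mul (m := m) 1 0 0 1
  rw [fromBlocks_one, Matrix.mul_one] at this
  rw [this]
  simp only [Matrix.zero_mul, Matrix.mul_zero, Matrix.mul_one, flip_mul_self]
  rw [← fromBlocks_one, fromBlocks_smul]
  congr 1
  · ext i j; simp; ring
  · simp
  · simp
  · ext i j; simp; ring

/-- A real symmetric matrix that commutes with the flip is block diagonal in the parity basis. -/
theorem parityBasis_conj_eq_fromBlocks {m : ℕ} {A B C D : Matrix (Fin m) (Fin m) ℝ}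
    (hD : D = flip m * A * flip m) (hC : C = flip m * B * flip m) :
    (parityBasis m)ᵀ * fromBlocks A B C D * parityBasis m =
      fromBlocks (A + B * flip m) 0 0 (A - B * flip m) := by
  have h1 : flip m * D * flip m = A := by
    rw [hD]
    calc _ = (flip m * flip m) * A * (flip m * flip m) := by simp only [Matrix.mul_assoc]
      _ = A := by simp [flip_mul_self]
  have h2 : flip m * C = B * flip m := by
    rw [hC]
    calc _ = (flip m * flip m) * B * flip m := by simp only [Matrix.mul_assoc]
      _ = _ := by simp [flip_mul_self]
  rw [parityBasis_transpose_mul_fromBlocks_mul, h1, h2, fromBlocks_smul]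
  congr 1
  · ext i j; simp; ring
  · ext i j; simp
  · ext i j; simp
  · ext i j; simp; ring

/-- Changing the sign on the second half makes even vectors odd and odd vectors even; this is how
partial transposition acts on the parity blocks. -/
theorem parityBasis_conj_sign (m : ℕ) :
    (parityBasis m)ᵀ * fromBlocks 1 0 0 (-1) * parityBasis m = fromBlocks 0 1 1 0 := by
  rw [parityBasis_transpose_mul_fromBlocks_mul, fromBlocks_smul]
  simp only [Matrix.zero_mul, Matrix.mul_zero, Matrix.mul_neg, Matrix.neg_mul, Matrix.mul_one,
    flip_mul_self]
  congr 1 <;> ext i j <;> simp <;> ring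

/-- The flip is `1` on even and `-1` on odd vectors, so a trace against it is a difference of traces
over the two blocks. -/
theorem parityBasis_conj_flip (m : ℕ) :
    (parityBasis m)ᵀ * fromBlocks 0 (flip m) (flip m) 0 * parityBasis m =
      fromBlocks 1 0 0 (-1) := by
  rw [parityBasis_transpose_mul_fromBlocks_mul, fromBlocks_smul]
  simp only [Matrix.zero_mul, Matrix.mul_zero, flip_mul_self]
  congr 1 <;> ext i j <;> simp <;> ring

theorem reindex_flip (m : ℕ) :
    (flip (m + m)).submatrix finSumFinEquiv finSumFinEquiv =
      fromBlocks 0 (flip m) (flip m) 0 := by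
  ext (i | i) (j | j) <;>
    simp only [submatrix_apply, finSumFinEquiv_apply_left, finSumFinEquiv_apply_right, flip,
      of_apply, fromBlocks_apply₁₁, fromBlocks_apply₁₂, fromBlocks_apply₂₁, fromBlocks_apply₂₂,
      Fin.ext_iff, Fin.val_rev, Fin.val_castAdd, Fin.val_natAdd, Matrix.zero_apply]
  · rw [if_neg]; omega
  · congr 1; rw [eq_iff_iff]; omega
  · congr 1; rw [eq_iff_iff]; omega
  · rw [if_neg]; omega

/-- The diagonal matrix with entries `1` on the first half and `-1` on the second half. -/
def halfSign (m : ℕ) : Matrix (Fin (m + m)) (Fin (m + m)) ℝ :=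
  diagonal fun i => if i.val < m then 1 else -1

theorem reindex_halfSign (m : ℕ) :
    (halfSign m).submatrix finSumFinEquiv finSumFinEquiv = fromBlocks 1 0 0 (-1) := by
  rw [halfSign, submatrix_diagonal_equiv]
  ext (i | i) (j | j) <;> simp [diagonal_apply, one_apply]
  split_ifs <;> simp

theorem reindex_eq_fromBlocks {m : ℕ} (V : Matrix (Fin (m + m)) (Fin (m + m)) ℝ) :
    V.submatrix finSumFinEquiv finSumFinEquiv =
      fromBlocks (V.submatrix (Fin.castAdd m) (Fin.castAdd m)) (offDiagBlock V)
        (V.submatrix (Fin.natAdd m) (Fin.castAdd m)) (V.submatrix (Fin.natAdd m) (Fin.natAdd m)) := by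
  ext (i | i) (j | j) <;> simp [offDiagBlock]

/-- The block of a circulant symmetric matrix on the vectors that are even under the flip. -/
def evenBlock {m : ℕ} (V : Matrix (Fin (m + m)) (Fin (m + m)) ℝ) : Matrix (Fin m) (Fin m) ℝ :=
  V.submatrix (Fin.castAdd m) (Fin.castAdd m) + offDiagBlock V * flip m

/-- The block of a circulant symmetric matrix on the vectors that are odd under the flip. -/
def oddBlock {m : ℕ} (V : Matrix (Fin (m + m)) (Fin (m + m)) ℝ) : Matrix (Fin m) (Fin m) ℝ :=
  V.submatrix (Fin.castAdd m) (Fin.castAdd m) - offDiagBlock V * flip m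

theorem IsCirculant.parityBasis_conj {m : ℕ} {V : Matrix (Fin (m + m)) (Fin (m + m)) ℝ}
    (h : IsCirculant V) (hs : V.IsSymm) :
    (parityBasis m)ᵀ * V.submatrix finSumFinEquiv finSumFinEquiv * parityBasis m =
      fromBlocks (evenBlock V) 0 0 (oddBlock V) := by
  rw [reindex_eq_fromBlocks]
  apply parityBasis_conj_eq_fromBlocks
  · ext i j
    rw [Matrix.mul_assoc, flip_mul_apply, mul_flip_apply, submatrix_apply, submatrix_apply,
      ← h.rev_rev hs]
    congr 1 <;> ext <;> simp <;> omega
  · ext i j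
    rw [Matrix.mul_assoc, flip_mul_apply, mul_flip_apply, offDiagBlock, submatrix_apply,
      submatrix_apply, ← h.rev_rev hs]
    congr 1 <;> ext <;> simp <;> omega

end HarmonicChain

/-! ### The common normal form of the square root and its reflection -/

namespace HarmonicChain

open Matrix

theorem IsCirculant.posDef_blocks {m : ℕ} {V : Matrix (Fin (m + m)) (Fin (m + m)) ℝ}
    (h : IsCirculant V) (hs : V.IsSymm) (hpos : V.PosDef) :
    (evenBlock V).PosDef ∧ (oddBlock V).PosDef := by
  have h1 : (V.submatrix finSumFinEquiv finSumFinEquiv).PosDef :=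
    hpos.submatrix finSumFinEquiv.injective
  have hinj : Function.Injective (parityBasis m).mulVec := by
    intro x y hxy
    have := congrArg ((parityBasis m)ᵀ.mulVec) hxy
    simpa [parityBasis_transpose_mul_self] using this
  have h2 := h1.conjTranspose_mul_mul_same hinj
  rw [conjTranspose_eq_transpose_of_trivial, h.parityBasis_conj hs] at h2
  exact ⟨h2.submatrix Sum.inl_injective, h2.submatrix Sum.inr_injective⟩

section Order

variable {ι : Type*} [Fintype ι] [DecidableEq ι]

/-- If `A² - B²` is semidefinite then so is the difference of the simultaneous diagonalizations of
`A` and `B`. -/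
theorem le_one_of_posSemidef_sq_sub_sq {A B K : Matrix ι ι ℝ} {ν : ι → ℝ} (hA : A.PosDef)
    (hB : B.IsSymm) (hKA : Kᵀ * A * K = 1) (hKB : Kᵀ * B * K = diagonal ν) (hν : ∀ i, 0 < ν i) :
    ((A * A - B * B).PosSemidef → ∀ i, ν i ≤ 1) ∧
      ((B * B - A * A).PosSemidef → ∀ i, 1 ≤ ν i) := by
  have hA' : Aᵀ = A := by
    have := hA.1
    rwa [IsHermitian, conjTranspose_eq_transpose_of_trivial] at this
  have hKA' : K * (Kᵀ * A) = 1 := mul_eq_one_comm.1 hKA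
  have hAK : A * K * Kᵀ = 1 := by
    have := congrArg transpose hKA'
    simpa [transpose_mul, hA', Matrix.mul_assoc] using this
  -- The columns of `K` are generalized eigenvectors of the pair `(B, A)`.
  have hBK : B * K = A * K * diagonal ν := by
    calc B * K = (A * K * Kᵀ) * B * K := by rw [hAK, Matrix.one_mul]
      _ = A * K * (Kᵀ * B * K) := by simp only [Matrix.mul_assoc]
      _ = _ := by rw [hKB]
  have hBK' : Kᵀ * B = diagonal ν * (Kᵀ * A) := by
    have := congrArg transpose hBK
    simpa [transpose_mul, hA', hB.eq, Matrix.mul_assoc] using this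
  have hsq : Kᵀ * (B * B) * K = diagonal ν * (Kᵀ * (A * A) * K) * diagonal ν := by
    calc _ = (Kᵀ * B) * (B * K) := by simp only [Matrix.mul_assoc]
      _ = _ := by rw [hBK, hBK']; simp only [Matrix.mul_assoc]
  -- On the `i`-th column of `K` the form `B²` is `ν i ^ 2` times the form `A²`, so the sign of `A²
  -- - B²` there compares `ν i ^ 2` with `1`.
  have hentry : ∀ i, (Kᵀ * (B * B) * K) i i = ν i ^ 2 * (Kᵀ * (A * A) * K) i i := by
    intro i
    rw [hsq, mul_diagonal, diagonal_mul]; ring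
  have hinj : Function.Injective (A * K).mulVec := by
    intro x y hxy
    have := congrArg (Kᵀ.mulVec) hxy
    simpa [← Matrix.mul_assoc, hKA] using this
  have hpos : ∀ i, 0 < (Kᵀ * (A * A) * K) i i := by
    have h1 := PosDef.conjTranspose_mul_self (A * K) hinj
    rw [conjTranspose_eq_transpose_of_trivial] at h1
    have h2 : (A * K)ᵀ * (A * K) = Kᵀ * (A * A) * K := by
      rw [transpose_mul, hA']; simp only [Matrix.mul_assoc]
    rw [h2] at h1
    intro i
    exact h1.diag_pos
  constructor
  · intro h i
    have h1 := h.conjTranspose_mul_mul_same K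
    rw [conjTranspose_eq_transpose_of_trivial, Matrix.mul_sub, Matrix.sub_mul] at h1
    have h2 := h1.diag_nonneg (i := i)
    rw [Matrix.sub_apply, hentry] at h2
    have h3 : ν i ^ 2 ≤ 1 := by
      by_contra hc
      nlinarith [hpos i]
    nlinarith [hν i]
  · intro h i
    have h1 := h.conjTranspose_mul_mul_same K
    rw [conjTranspose_eq_transpose_of_trivial, Matrix.mul_sub, Matrix.sub_mul] at h1
    have h2 := h1.diag_nonneg (i := i)
    rw [Matrix.sub_apply, hentry] at h2
    have h3 : 1 ≤ ν i ^ 2 := by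
      by_contra hc
      nlinarith [hpos i]
    nlinarith [hν i]

end Order

/-- The matrices that a circulant symmetric positive definite potential `V` gives rise to:
the square root `S` of `V`, and a basis `M` that diagonalizes `S` and its reflection `P S P`
simultaneously. -/
theorem exists_normalForm {m : ℕ} {V : Matrix (Fin (m + m)) (Fin (m + m)) ℝ}
    (h : IsCirculant V) (hs : V.IsSymm) (hpos : V.PosDef) :
    ∃ (S M : Matrix (Fin (m + m)) (Fin (m + m)) ℝ) (s t : Fin (m + m) → ℝ) (ν : Fin m → ℝ),
      S.PosDef ∧ S * S = V ∧ M.det ≠ 0 ∧ (∀ i, 0 < s i) ∧ (∀ i, 0 < t i) ∧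
      Mᵀ * S * M = diagonal s ∧ Mᵀ * (halfSign m * S * halfSign m) * M = diagonal t ∧
      (∀ j, 0 < ν j) ∧
      (∀ f : ℝ → ℝ → ℝ, ∑ i, f (s i) (t i) = ∑ j, f 1 (ν j) + ∑ j, f (ν j) 1) ∧
      (flip (m + m) * matrixLog2 V).trace = -(2 * ∑ j, Real.logb 2 (ν j)) ∧
      (IsSemidefinite (offDiagBlock V * flip m) → (∀ j, ν j ≤ 1) ∨ ∀ j, 1 ≤ ν j) := by
  obtain ⟨hA, hB⟩ := h.posDef_blocks hs hpos
  have hsymm : ∀ {A : Matrix (Fin m) (Fin m) ℝ}, A.PosDef → A.IsSymm := by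
    intro A hA
    have := hA.1
    rwa [IsHermitian, conjTranspose_eq_transpose_of_trivial] at this
  obtain ⟨U, α, hU, hU', hUA⟩ := exists_orthogonal_diagonalization (hsymm hA)
  obtain ⟨W, β, hW, hW', hWB⟩ := exists_orthogonal_diagonalization (hsymm hB)
  have hα := conj_diagonal_pos hA hU hUA
  have hβ := conj_diagonal_pos hB hW hWB
  set A : Matrix (Fin m) (Fin m) ℝ := U * diagonal (fun i => √(α i)) * Uᵀ with hAdef
  set B : Matrix (Fin m) (Fin m) ℝ := W * diagonal (fun i => √(β i)) * Wᵀ with hBdef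
  have hApos : A.PosDef := posDef_conj_diagonal hU' fun i => Real.sqrt_pos.2 (hα i)
  have hBpos : B.PosDef := posDef_conj_diagonal hW' fun i => Real.sqrt_pos.2 (hβ i)
  have hsqrt : ∀ {X : Matrix (Fin m) (Fin m) ℝ} {d : Fin m → ℝ}, Xᵀ * X = 1 → X * Xᵀ = 1 →
      (∀ i, 0 < d i) → X * diagonal (fun i => √(d i)) * Xᵀ *
        (X * diagonal (fun i => √(d i)) * Xᵀ) = X * diagonal d * Xᵀ := by
    intro X d hX hX' hd
    rw [← sq, pow_conj_diagonal hX hX']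
    congr 3
    ext i
    exact Real.sq_sqrt (hd i).le
  have hAA : A * A = evenBlock V := by rw [hAdef, hsqrt hU hU' hα, hUA]
  have hBB : B * B = oddBlock V := by rw [hBdef, hsqrt hW hW' hβ, hWB]
  obtain ⟨K, ν, hKA, hKB⟩ := exists_simultaneous_diagonalization hApos (hsymm hBpos)
  have hKdet : K.det ≠ 0 := by
    intro h0
    have := congrArg det hKA
    simp [h0] at this
  have hKinj : Function.Injective K.mulVec := by
    intro x y hxy
    have := congrArg ((Kᵀ * A).mulVec) hxy
    simpa [hKA] using this
  have hν : ∀ j, 0 < ν j := by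
    have h1 := hBpos.conjTranspose_mul_mul_same hKinj
    rw [conjTranspose_eq_transpose_of_trivial, hKB] at h1
    exact posDef_diagonal_iff.1 h1
  set Q := parityBasis m with hQ
  have hQ1 : Qᵀ * Q = 1 := parityBasis_transpose_mul_self m
  have hQ2 : Q * Qᵀ = 1 := mul_eq_one_comm.1 hQ1
  let e : Fin m ⊕ Fin m ≃ Fin (m + m) := finSumFinEquiv
  have hconj : ∀ X : Matrix (Fin m ⊕ Fin m) (Fin m ⊕ Fin m) ℝ, X = Q * (Qᵀ * X * Q) * Qᵀ := by
    intro X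
    calc X = (Q * Qᵀ) * X * (Q * Qᵀ) := by simp [hQ2]
      _ = _ := by simp only [Matrix.mul_assoc]
  have hre : ∀ X : Matrix (Fin (m + m)) (Fin (m + m)) ℝ,
      X = (X.submatrix e e).submatrix e.symm e.symm := by
    intro X; ext i j; simp
  have hmul : ∀ X Y : Matrix (Fin m ⊕ Fin m) (Fin m ⊕ Fin m) ℝ,
      X.submatrix e.symm e.symm * Y.submatrix e.symm e.symm =
        (X * Y).submatrix e.symm e.symm := fun X Y => submatrix_mul_equiv X Y _ e.symm _
  have hdiag : ∀ d : Fin m ⊕ Fin m → ℝ,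
      (diagonal d).submatrix e.symm e.symm = diagonal (d ∘ e.symm) :=
    fun d => submatrix_diagonal_equiv d e.symm
  have hV : V = (Q * fromBlocks (evenBlock V) 0 0 (oddBlock V) * Qᵀ).submatrix e.symm e.symm := by
    rw [← h.parityBasis_conj hs, ← hQ, ← hconj]; exact hre V
  have hP : halfSign m = (Q * fromBlocks 0 1 1 0 * Qᵀ).submatrix e.symm e.symm := by
    rw [← parityBasis_conj_sign, ← hQ, ← hconj, ← reindex_halfSign]; exact hre _
  have hF : flip (m + m) = (Q * fromBlocks 1 0 0 (-1) * Qᵀ).submatrix e.symm e.symm := by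
    rw [← parityBasis_conj_flip, ← hQ, ← hconj, ← reindex_flip]; exact hre _
  have hO : ∀ X Y : Matrix (Fin m) (Fin m) ℝ, Xᵀ * X = 1 → Yᵀ * Y = 1 →
      (Q * fromBlocks X 0 0 Y)ᵀ * (Q * fromBlocks X 0 0 Y) = 1 := by
    intro X Y hX hY
    calc _ = (fromBlocks X 0 0 Y)ᵀ * (Qᵀ * Q) * fromBlocks X 0 0 Y := by
          simp only [transpose_mul, Matrix.mul_assoc]
      _ = 1 := by
          rw [hQ1, Matrix.mul_one, fromBlocks_transpose, fromBlocks_multiply]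
          simp [hX, hY]
  set O := Q * fromBlocks U 0 0 W with hOdef
  have hO1 : Oᵀ * O = 1 := hO U W hU hW
  have hdiagO : ∀ a b : Fin m → ℝ, Q * fromBlocks (U * diagonal a * Uᵀ) 0 0 (W * diagonal b * Wᵀ) *
      Qᵀ = O * diagonal (Sum.elim a b) * Oᵀ := by
    intro a b
    have : fromBlocks (U * diagonal a * Uᵀ) 0 0 (W * diagonal b * Wᵀ) =
        fromBlocks U 0 0 W * diagonal (Sum.elim a b) * (fromBlocks U 0 0 W)ᵀ := by
      rw [← fromBlocks_diagonal, fromBlocks_transpose, fromBlocks_multiply, fromBlocks_multiply]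
      simp
    rw [this, hOdef]
    simp only [transpose_mul, Matrix.mul_assoc]
  set O' := O.submatrix e.symm e.symm with hO'
  have hO'T : O'ᵀ = Oᵀ.submatrix e.symm e.symm := by rw [hO', transpose_submatrix]
  have hO'1 : O'ᵀ * O' = 1 := by
    rw [hO'T, hO', hmul, hO1]; exact submatrix_one_equiv _
  have hO'2 : O' * O'ᵀ = 1 := mul_eq_one_comm.1 hO'1
  have hsubO : ∀ a b : Fin m → ℝ,
      (Q * fromBlocks (U * diagonal a * Uᵀ) 0 0 (W * diagonal b * Wᵀ) * Qᵀ).submatrix e.symm e.symm =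
      O' * diagonal (Sum.elim a b ∘ e.symm) * O'ᵀ := by
    intro a b
    rw [hdiagO, hO'T, hO', ← hdiag, hmul, hmul]
  set M := Q * fromBlocks K 0 0 K with hM
  have hMX : ∀ X Y : Matrix (Fin m) (Fin m) ℝ,
      Mᵀ * (Q * fromBlocks X 0 0 Y * Qᵀ) * M =
        fromBlocks (Kᵀ * X * K) 0 0 (Kᵀ * Y * K) := by
    intro X Y
    calc _ = (fromBlocks K 0 0 K)ᵀ * (Qᵀ * Q) * fromBlocks X 0 0 Y * (Qᵀ * Q) *
          fromBlocks K 0 0 K := by simp only [hM, transpose_mul, Matrix.mul_assoc]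
      _ = _ := by
          rw [hQ1, Matrix.mul_one, Matrix.mul_one, fromBlocks_transpose, fromBlocks_multiply,
            fromBlocks_multiply]
          simp
  -- The reflection exchanges `A` and `B`. As the same `K` is used on both parities, `M`
  -- diagonalizes the reflected matrix too.
  have hPS : (Q * fromBlocks 0 1 1 0 * Qᵀ) * (Q * fromBlocks A 0 0 B * Qᵀ) *
      (Q * fromBlocks 0 1 1 0 * Qᵀ) = Q * fromBlocks B 0 0 A * Qᵀ := by
    calc _ = Q * (fromBlocks 0 1 1 0 * (Qᵀ * Q) * fromBlocks A 0 0 B * (Qᵀ * Q) *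
          fromBlocks 0 1 1 0) * Qᵀ := by simp only [Matrix.mul_assoc]
      _ = _ := by
          rw [hQ1, Matrix.mul_one, Matrix.mul_one, fromBlocks_multiply, fromBlocks_multiply]
          simp
  refine ⟨(Q * fromBlocks A 0 0 B * Qᵀ).submatrix e.symm e.symm, M.submatrix e.symm e.symm,
    Sum.elim 1 ν ∘ e.symm, Sum.elim ν 1 ∘ e.symm, ν, ?_, ?_, ?_, ?_, ?_, ?_, ?_, hν, ?_, ?_, ?_⟩
  · rw [hAdef, hBdef, hsubO]
    apply posDef_conj_diagonal hO'2
    intro i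
    simp only [Function.comp_apply]
    rcases e.symm i with j | j
    · exact Real.sqrt_pos.2 (hα j)
    · exact Real.sqrt_pos.2 (hβ j)
  · rw [hmul]
    conv_rhs => rw [hV]
    congr 1
    calc _ = Q * (fromBlocks A 0 0 B * (Qᵀ * Q) * fromBlocks A 0 0 B) * Qᵀ := by
          simp only [Matrix.mul_assoc]
      _ = _ := by
          rw [hQ1, Matrix.mul_one, fromBlocks_multiply]
          simp [hAA, hBB]
  · rw [det_submatrix_equiv_self, hM, det_mul, det_fromBlocks_zero₂₁]
    have hQdet : Q.det ≠ 0 := by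
      intro h0
      have := congrArg det hQ1
      simp [h0] at this
    exact mul_ne_zero hQdet (mul_ne_zero hKdet hKdet)
  · intro i
    simp only [Function.comp_apply]
    rcases e.symm i with j | j
    · simp
    · exact hν j
  · intro i
    simp only [Function.comp_apply]
    rcases e.symm i with j | j
    · exact hν j
    · simp
  · rw [transpose_submatrix, hmul, hmul, hMX, hKA, hKB, ← hdiag, ← fromBlocks_diagonal]
    rfl
  · rw [hP, transpose_submatrix, hmul, hmul, hPS, hmul, hmul, hMX, hKA, hKB, ← hdiag,
      ← fromBlocks_diagonal]
    rfl
  · intro f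
    rw [← e.sum_comp, Fintype.sum_sum_type]
    simp
  · have hlog : matrixLog2 V = (O * diagonal (Sum.elim (fun i => Real.logb 2 (α i))
        fun i => Real.logb 2 (β i)) * Oᵀ).submatrix e.symm e.symm := by
      have hVO : V = O' * diagonal (Sum.elim α β ∘ e.symm) * O'ᵀ := by
        rw [← hsubO, ← hUA, ← hWB]; exact hV
      rw [matrixLog2, hVO, cfc_conj_diagonal hO'1 hO'2, ← hmul, ← hmul, hdiag, hO'T, hO']
      congr 3
      ext i
      simp only [Function.comp_apply]
      rcases e.symm i with j | j <;> simp
    have htr : (flip (m + m) * matrixLog2 V).trace =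
        ∑ i, Real.logb 2 (α i) - ∑ i, Real.logb 2 (β i) := by
      rw [hlog, hF, hmul]
      have h1 : ∀ X : Matrix (Fin m ⊕ Fin m) (Fin m ⊕ Fin m) ℝ,
          (X.submatrix e.symm e.symm).trace = X.trace := by
        intro X
        simp only [Matrix.trace, diag_apply, submatrix_apply]
        exact e.symm.sum_comp fun i => X i i
      have h2 : Oᵀ * (Q * fromBlocks 1 0 0 (-1) * Qᵀ) * O = fromBlocks 1 0 0 (-1) := by
        calc _ = (fromBlocks U 0 0 W)ᵀ * (Qᵀ * Q) * fromBlocks 1 0 0 (-1) * (Qᵀ * Q) *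
              fromBlocks U 0 0 W := by simp only [hOdef, transpose_mul, Matrix.mul_assoc]
          _ = _ := by
              rw [hQ1, Matrix.mul_one, Matrix.mul_one, fromBlocks_transpose, fromBlocks_multiply,
                fromBlocks_multiply]
              simp [hU, hW]
      rw [h1, ← Matrix.mul_assoc, trace_mul_comm, ← Matrix.mul_assoc, ← Matrix.mul_assoc, h2,
        ← fromBlocks_diagonal, fromBlocks_multiply]
      simp [Matrix.trace, sub_eq_add_neg]
    rw [htr]
    have hdetA : A.det = ∏ i, √(α i) := by
      rw [hAdef, det_mul, det_mul, mul_right_comm, ← det_mul, hU', det_one, one_mul, det_diagonal]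
    have hdetB : B.det = ∏ i, √(β i) := by
      rw [hBdef, det_mul, det_mul, mul_right_comm, ← det_mul, hW', det_one, one_mul, det_diagonal]
    -- Determinants of the two congruences, with `det K` eliminated: `∏ ν · det A = det B`.
    have hprod : (∏ j, ν j) * ∏ i, √(α i) = ∏ i, √(β i) := by
      have h1 := congrArg det hKA
      have h2 := congrArg det hKB
      simp only [det_mul, det_transpose, det_one, det_diagonal] at h1 h2
      rw [← hdetA, ← hdetB, ← h2]
      linear_combination B.det * h1
    have hlogprod : ∀ f : Fin m → ℝ, (∀ i, 0 < f i) →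
        Real.logb 2 (∏ i, f i) = ∑ i, Real.logb 2 (f i) :=
      fun f hf => Real.logb_prod _ _ fun i _ => (hf i).ne'
    have hsq : ∀ f : Fin m → ℝ, (∀ i, 0 < f i) →
        Real.logb 2 (∏ i, √(f i)) = (∑ i, Real.logb 2 (f i)) / 2 := by
      intro f hf
      rw [hlogprod _ fun i => Real.sqrt_pos.2 (hf i), Finset.sum_div]
      refine Finset.sum_congr rfl fun i _ => ?_
      rw [Real.logb, Real.log_sqrt (hf i).le, Real.logb]
      ring
    have h3 := congrArg (Real.logb 2) hprod
    rw [Real.logb_mul (Finset.prod_pos fun i _ => hν i).ne'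
      (Finset.prod_pos fun i _ => Real.sqrt_pos.2 (hα i)).ne', hsq α hα, hsq β hβ,
      hlogprod ν hν] at h3
    linarith
  · obtain ⟨hle, hge⟩ := le_one_of_posSemidef_sq_sub_sq hApos (hsymm hBpos) hKA hKB hν
    -- The even and odd blocks are `V' ± V''F`, with `V'` the upper left block; this is where the
    -- semidefiniteness of `V''F` enters.
    have hdiff : A * A - B * B = (2 : ℝ) • (offDiagBlock V * flip m) := by
      rw [hAA, hBB, evenBlock, oddBlock, two_smul]; abel
    rintro (h1 | h1)
    · left
      apply hle
      rw [hdiff]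
      exact h1.smul (by norm_num)
    · right
      apply hge
      rw [← neg_sub, hdiff, ← smul_neg]
      exact h1.smul (by norm_num)

end HarmonicChain

/-! ### The spectrum of the partially transposed covariance matrix -/

namespace HarmonicChain

open Matrix

theorem charpoly_eq_of_conj {ι R : Type*} [Fintype ι] [DecidableEq ι] [CommRing R]
    {A B G H : Matrix ι ι R} (hHG : H * G = 1) (h : A = G * B * H) : A.charpoly = B.charpoly := by
  rw [h, charpoly_mul_comm, ← Matrix.mul_assoc, hHG, Matrix.one_mul]

/-- Each index contributes a `2 × 2` block with zero diagonal and eigenvectors `(a, ±r)`; the matrix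
of these and its inverse are written out. -/
theorem charpoly_antidiagonal {ι : Type*} [Fintype ι] [DecidableEq ι] {a b r : ι → ℂ}
    (ha : ∀ i, a i ≠ 0) (hr : ∀ i, r i ≠ 0) (h : ∀ i, r i ^ 2 = a i * b i) :
    (fromBlocks 0 (diagonal a) (diagonal b) 0).charpoly =
      (diagonal (Sum.elim r (-r))).charpoly := by
  have hHG : fromBlocks (diagonal fun i => 1 / (2 * a i)) (diagonal fun i => 1 / (2 * r i))
      (diagonal fun i => 1 / (2 * a i)) (diagonal fun i => -(1 / (2 * r i))) *
      fromBlocks (diagonal a) (diagonal a) (diagonal r) (diagonal (-r)) = 1 := by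
    rw [fromBlocks_multiply]
    simp only [diagonal_mul_diagonal, diagonal_add]
    rw [← fromBlocks_one, ← diagonal_one]
    have h0 : (0 : Matrix ι ι ℂ) = diagonal fun _ => 0 := by rw [diagonal_zero]
    rw [h0]
    congr 2 <;> ext i <;> have := ha i <;> have := hr i <;> (try simp only [Pi.neg_apply]) <;>
      field_simp <;> ring
  refine charpoly_eq_of_conj hHG ?_
  have hGH := mul_eq_one_comm.1 hHG
  have key : fromBlocks 0 (diagonal a) (diagonal b) 0 *
      fromBlocks (diagonal a) (diagonal a) (diagonal r) (diagonal (-r)) =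
      fromBlocks (diagonal a) (diagonal a) (diagonal r) (diagonal (-r)) *
        diagonal (Sum.elim r (-r)) := by
    rw [← fromBlocks_diagonal, fromBlocks_multiply, fromBlocks_multiply]
    simp only [Matrix.zero_mul, Matrix.mul_zero, add_zero, zero_add, diagonal_mul_diagonal]
    congr 2 <;> ext i <;> (try simp only [Pi.neg_apply]) <;> linear_combination -h i
  rw [← key, Matrix.mul_assoc, hGH, Matrix.mul_one]

theorem symplecticMatrix_inv (n : ℕ) :
    (symplecticMatrix n)⁻¹ = fromBlocks 0 (-1) 1 0 := by
  apply inv_eq_right_inv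
  rw [symplecticMatrix, fromBlocks_multiply]
  simp

/-- Momentum reversal leaves `S⁻¹` alone and reflects `S`. A similarity by `(Mᵀ)⁻¹ ⊕ M` then leaves
antidiagonal blocks of sizes `t/2` and `1/(2s)`, with eigenvalues `±½ √(t/s)`; the two signs
together turn the square root into the full `log₂ (s/t)`. -/
theorem negativitySum_eq {m : ℕ} {S M : Matrix (Fin (m + m)) (Fin (m + m)) ℝ}
    {s t : Fin (m + m) → ℝ} (hM : M.det ≠ 0) (hs : ∀ i, 0 < s i) (ht : ∀ i, 0 < t i)
    (hS : Mᵀ * S * M = diagonal s)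
    (hS' : Mᵀ * (halfSign m * S * halfSign m) * M = diagonal t) :
    negativitySum (fromBlocks ((1 / 2 : ℝ) • S⁻¹) 0 0 ((1 / 2 : ℝ) • S)) =
      ∑ i, max 0 (Real.logb 2 (s i / t i)) := by
  have hu : IsUnit M.det := isUnit_iff_ne_zero.2 hM
  have huT : IsUnit Mᵀ.det := by rwa [det_transpose]
  have hMM := nonsing_inv_mul M hu
  have hMM' := mul_nonsing_inv M hu
  have hMT := nonsing_inv_mul Mᵀ huT
  have hMT' := mul_nonsing_inv Mᵀ huT
  have hSinv : S⁻¹ = M * diagonal (fun i => (s i)⁻¹) * Mᵀ := by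
    apply inv_eq_right_inv
    have h1 : Mᵀ * S * M * diagonal (fun i => (s i)⁻¹) = 1 := by
      rw [hS, diagonal_mul_diagonal, ← diagonal_one]
      congr 1; ext i; exact mul_inv_cancel₀ (hs i).ne'
    have h2 : Mᵀ * (S * M * diagonal (fun i => (s i)⁻¹)) = 1 := by
      rw [← h1]; simp only [Matrix.mul_assoc]
    rw [← mul_eq_one_comm.1 h2]; simp only [Matrix.mul_assoc]
  have hPSP : halfSign m * S * halfSign m = Mᵀ⁻¹ * diagonal t * M⁻¹ := by
    rw [← hS']
    calc _ = (Mᵀ⁻¹ * Mᵀ) * (halfSign m * S * halfSign m) * (M * M⁻¹) := by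
          rw [hMT, hMM', Matrix.one_mul, Matrix.mul_one]
      _ = _ := by simp only [Matrix.mul_assoc]
  have hreal : (symplecticMatrix (m + m))⁻¹ * (momentumReversal m *
      fromBlocks ((1 / 2 : ℝ) • S⁻¹) 0 0 ((1 / 2 : ℝ) • S) * momentumReversal m) =
      fromBlocks Mᵀ⁻¹ 0 0 M * fromBlocks 0 (diagonal fun i => -(t i / 2))
        (diagonal fun i => (s i)⁻¹ / 2) 0 * fromBlocks Mᵀ 0 0 M⁻¹ := by
    have hmom : momentumReversal m = fromBlocks 1 0 0 (halfSign m) := rfl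
    rw [symplecticMatrix_inv, hmom]
    simp only [fromBlocks_multiply, Matrix.one_mul, Matrix.mul_one, Matrix.zero_mul,
      Matrix.mul_zero, add_zero, zero_add, Matrix.mul_smul, Matrix.smul_mul, Matrix.neg_mul]
    have e1 : diagonal (fun i => -(t i / 2)) = -((1 / 2 : ℝ) • diagonal t) := by
      ext i j; by_cases hij : i = j <;> simp [hij]; ring
    have e2 : diagonal (fun i => (s i)⁻¹ / 2) = (1 / 2 : ℝ) • diagonal (fun i => (s i)⁻¹) := by
      ext i j; by_cases hij : i = j <;> simp [hij]; ring
    rw [e1, e2, hSinv, hPSP]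
    simp
  have hmat : negativityMatrix (fromBlocks ((1 / 2 : ℝ) • S⁻¹) 0 0 ((1 / 2 : ℝ) • S)) =
      (fromBlocks Mᵀ⁻¹ 0 0 M).map Complex.ofReal *
        fromBlocks 0 (diagonal fun i => -Complex.I * (t i / 2))
          (diagonal fun i => Complex.I * ((s i)⁻¹ / 2)) 0 *
        (fromBlocks Mᵀ 0 0 M⁻¹).map Complex.ofReal := by
    rw [negativityMatrix, hreal]
    have hmap : ∀ X Y : Matrix (Fin (m + m) ⊕ Fin (m + m)) (Fin (m + m) ⊕ Fin (m + m)) ℝ,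
        (X * Y).map Complex.ofReal = X.map Complex.ofReal * Y.map Complex.ofReal :=
      fun X Y => Matrix.map_mul (f := Complex.ofRealHom)
    rw [hmap, hmap, ← Matrix.smul_mul, ← Matrix.mul_smul]
    congr 2
    ext (i | i) (j | j)
    · simp
    · by_cases hij : i = j <;> simp [hij]
    · by_cases hij : i = j <;> simp [hij]
    · simp
  have hHG : (fromBlocks Mᵀ 0 0 M⁻¹).map Complex.ofReal *
      (fromBlocks Mᵀ⁻¹ 0 0 M).map Complex.ofReal = 1 := by
    have h1 : fromBlocks Mᵀ 0 0 M⁻¹ * fromBlocks Mᵀ⁻¹ 0 0 M = 1 := by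
      rw [fromBlocks_multiply]; simp [hMM, hMT']
    have h2 := congrArg (fun X => X.map Complex.ofRealHom) h1
    simp only [Matrix.map_mul] at h2
    rw [Matrix.map_one _ (map_zero _) (map_one _)] at h2
    exact h2
  set r : Fin (m + m) → ℂ := fun i => ((√(t i / s i) / 2 : ℝ) : ℂ) with hr
  have hri : ∀ i, r i = ((√(t i / s i) / 2 : ℝ) : ℂ) := fun i => rfl
  have hrpos : ∀ i, 0 < √(t i / s i) := fun i => Real.sqrt_pos.2 (div_pos (ht i) (hs i))
  have hchar : (negativityMatrix (fromBlocks ((1 / 2 : ℝ) • S⁻¹) 0 0 ((1 / 2 : ℝ) • S))).charpoly =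
      (diagonal (Sum.elim r (-r))).charpoly := by
    rw [charpoly_eq_of_conj hHG hmat]
    apply charpoly_antidiagonal
    · intro i
      have := (ht i).ne'
      simp [this]
    · intro i
      rw [hri]
      exact_mod_cast (div_pos (hrpos i) two_pos).ne'
    · intro i
      have h1 : (√(t i / s i) / 2) ^ 2 = (t i / 2) * ((s i)⁻¹ / 2) := by
        rw [div_pow, Real.sq_sqrt (div_pos (ht i) (hs i)).le]; ring
      have h2 : r i ^ 2 = (t i / 2) * (((s i)⁻¹ : ℝ) / 2) := by
        rw [hri]; exact_mod_cast h1
      rw [h2]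
      linear_combination ((t i / 2 : ℂ) * (((s i)⁻¹ : ℝ) / 2)) * Complex.I_mul_I
  rw [negativitySum, hchar, charpoly_diagonal]
  have hroots : (∏ i, (Polynomial.X - Polynomial.C (Sum.elim r (-r) i))).roots =
      Finset.univ.val.map (Sum.elim r (-r)) := by
    rw [← Polynomial.roots_multiset_prod_X_sub_C (Finset.univ.val.map (Sum.elim r (-r))),
      Multiset.map_map]
    rfl
  rw [hroots, Multiset.map_map]
  change -(∑ i, Real.logb 2 (min 1 (2 * ‖Sum.elim r (-r) i‖))) = _
  have hnorm : ∀ i, ‖r i‖ = √(t i / s i) / 2 := by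
    intro i
    rw [hr, Complex.norm_real, Real.norm_of_nonneg (div_pos (hrpos i) two_pos).le]
  rw [Fintype.sum_sum_type]
  simp only [Sum.elim_inl, Sum.elim_inr, Pi.neg_apply, norm_neg, hnorm]
  rw [← Finset.sum_add_distrib, ← Finset.sum_neg_distrib]
  refine Finset.sum_congr rfl fun i _ => ?_
  rw [mul_div_cancel₀ _ (two_ne_zero' ℝ)]
  have hlog : Real.logb 2 (√(t i / s i)) = -(Real.logb 2 (s i / t i) / 2) := by
    rw [← inv_div, Real.sqrt_inv, Real.logb_inv, Real.logb, Real.log_sqrt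
      (div_pos (hs i) (ht i)).le, Real.logb]
    ring
  rcases le_total 1 (√(t i / s i)) with h1 | h1
  · rw [min_eq_left h1, Real.logb_one]
    have := Real.logb_nonneg one_lt_two h1
    rw [max_eq_left (by linarith)]
    simp
  · rw [min_eq_right h1, hlog]
    have := Real.logb_nonpos one_lt_two (hrpos i).le h1
    rw [max_eq_right (by linarith)]
    ring

end HarmonicChain

/-! ### Trace norms of series of rank one operators -/

namespace HarmonicChain

open MeasureTheory

section TraceNorm

variable {n : ℕ} {K : Type*}

/-- An operator `∑ₖ εₖ |gₖ⟩⟨gₖ|` with signs `εₖ` that are implemented by an isometry, `U gₖ = εₖ gₖ`,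
has trace norm `∑ₖ ‖gₖ‖²`. -/
theorem traceNorm_eq_tsum {κ : (Fin n → ℝ) → (Fin n → ℝ) → ℂ}
    {g : K → Lp ℂ 2 (volume : Measure (Fin n → ℝ))} {ε : K → ℂ}
    (hε : ∀ k, ε k = 1 ∨ ε k = -1) (hsum : Summable fun k => ‖g k‖ ^ 2)
    (U : Lp ℂ 2 (volume : Measure (Fin n → ℝ)) →ₗᵢ[ℂ] Lp ℂ 2 (volume : Measure (Fin n → ℝ)))
    (hU : ∀ k, U (g k) = ε k • g k)
    (hκ : ∀ e f : Lp ℂ 2 (volume : Measure (Fin n → ℝ)),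
      HasSum (fun k => ε k * (inner ℂ e (g k) * inner ℂ (g k) f))
        (∫ x, conj (e x) * ∫ y, κ x y * f y)) :
    traceNorm κ = ENNReal.ofReal (∑' k, ‖g k‖ ^ 2) := by
  have hεn : ∀ k, ‖ε k‖ = 1 := by
    intro k; rcases hε k with h | h <;> simp [h]
  apply le_antisymm
  -- Upper bound: `|⟨e, g⟩⟨g, f⟩|` is at most the mean of the two squares, and Bessel's inequality
  -- for `e` and for `f` bounds the sum over `i` by `‖g k‖²`.
  · refine iSup_le fun r => iSup_le fun e => iSup_le fun f => iSup_le fun he => iSup_le fun hf => ?_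
    have hterm : ∀ i k, ‖ε k * (inner ℂ (e i) (g k) * inner ℂ (g k) (f i))‖ ≤
        (‖(inner ℂ (e i) (g k) : ℂ)‖ ^ 2 + ‖(inner ℂ (f i) (g k) : ℂ)‖ ^ 2) / 2 := by
      intro i k
      rw [norm_mul, hεn, one_mul, norm_mul, norm_inner_symm (g k) (f i)]
      nlinarith [sq_nonneg (‖(inner ℂ (e i) (g k) : ℂ)‖ - ‖(inner ℂ (f i) (g k) : ℂ)‖)]
    have hle : ∀ {v : Fin r → Lp ℂ 2 (volume : Measure (Fin n → ℝ))}, Orthonormal ℂ v →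
        ∀ i k, ‖(inner ℂ (v i) (g k) : ℂ)‖ ^ 2 ≤ ‖g k‖ ^ 2 := by
      intro v hv i k
      have := norm_inner_le_norm (𝕜 := ℂ) (v i) (g k)
      rw [hv.1 i, one_mul] at this
      gcongr
    have hsummable : ∀ {v : Fin r → Lp ℂ 2 (volume : Measure (Fin n → ℝ))}, Orthonormal ℂ v →
        ∀ i, Summable fun k => ‖(inner ℂ (v i) (g k) : ℂ)‖ ^ 2 := fun hv i =>
      Summable.of_nonneg_of_le (fun k => sq_nonneg _) (hle hv i) hsum
    have hsummable2 : ∀ i, Summable fun k =>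
        (‖(inner ℂ (e i) (g k) : ℂ)‖ ^ 2 + ‖(inner ℂ (f i) (g k) : ℂ)‖ ^ 2) / 2 :=
      fun i => ((hsummable he i).add (hsummable hf i)).div_const 2
    have hbound : ∀ i, ‖∫ x, conj (e i x) * ∫ y, κ x y * f i y‖ ≤
        ∑' k, (‖(inner ℂ (e i) (g k) : ℂ)‖ ^ 2 + ‖(inner ℂ (f i) (g k) : ℂ)‖ ^ 2) / 2 := by
      intro i
      rw [← (hκ (e i) (f i)).tsum_eq]
      exact tsum_of_norm_bounded (hsummable2 i).hasSum (hterm i)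
    have htotal : ∑ i, ‖∫ x, conj (e i x) * ∫ y, κ x y * f i y‖ ≤ ∑' k, ‖g k‖ ^ 2 := by
      refine (Finset.sum_le_sum fun i _ => hbound i).trans ?_
      rw [← Summable.tsum_finsetSum fun i _ => hsummable2 i]
      refine Summable.tsum_le_tsum (fun k => ?_) (summable_sum fun i _ => hsummable2 i) hsum
      rw [← Finset.sum_div, Finset.sum_add_distrib]
      have h1 := he.sum_inner_products_le (g k) (s := Finset.univ)
      have h2 := hf.sum_inner_products_le (g k) (s := Finset.univ)
      linarith
    calc ∑ i, ‖∫ x, conj (e i x) * ∫ y, κ x y * f i y‖ₑ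
        = ENNReal.ofReal (∑ i, ‖∫ x, conj (e i x) * ∫ y, κ x y * f i y‖) := by
          rw [ENNReal.ofReal_sum_of_nonneg fun i _ => norm_nonneg _]
          simp only [ofReal_norm]
      _ ≤ _ := ENNReal.ofReal_le_ofReal htotal
  · rw [ENNReal.ofReal_tsum_of_nonneg (fun k => sq_nonneg _) hsum, ENNReal.tsum_eq_iSup_sum]
    refine iSup_le fun A => ?_
    classical
    -- Lower bound: test with an orthonormal basis `b` of the span of finitely many `g k`, and with
    -- `U b`. The signs cancel, so every term is `|⟨b i, g k⟩|² ≥ 0`, and Parseval in `E` recovers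
    -- `‖g k‖²` for `k ∈ A`.
    let E : Submodule ℂ (Lp ℂ 2 (volume : Measure (Fin n → ℝ))) :=
      Submodule.span ℂ (A.image g : Set (Lp ℂ 2 (volume : Measure (Fin n → ℝ))))
    have : FiniteDimensional ℂ E := FiniteDimensional.span_finset ℂ _
    let b := stdOrthonormalBasis ℂ E
    have hb : Orthonormal ℂ fun i => (b i : Lp ℂ 2 (volume : Measure (Fin n → ℝ))) :=
      b.orthonormal.comp_linearIsometry E.subtypeₗᵢ
    have hUb : Orthonormal ℂ fun i => U (b i : Lp ℂ 2 (volume : Measure (Fin n → ℝ))) :=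
      hb.comp_linearIsometry U
    refine le_trans ?_ (le_iSup_of_le _ (le_iSup_of_le _ (le_iSup_of_le _ (le_iSup_of_le hb
      (le_iSup_of_le hUb le_rfl)))))
    have hval : ∀ i, HasSum (fun k => ((‖(inner ℂ (b i : Lp ℂ 2 (volume : Measure (Fin n → ℝ)))
        (g k) : ℂ)‖ ^ 2 : ℝ) : ℂ)) (∫ x, conj ((b i : Lp ℂ 2 (volume : Measure (Fin n → ℝ))) x) *
          ∫ y, κ x y * U (b i : Lp ℂ 2 (volume : Measure (Fin n → ℝ))) y) := by
      intro i
      convert hκ (b i) (U (b i)) using 2 with k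
      -- Preservation of inner products is enough here: `⟨g, b⟩ = ⟨U g, U b⟩ = ε ⟨g, U b⟩`, as `ε`
      -- is real.
      have h1 : inner ℂ (g k) (U (b i : Lp ℂ 2 (volume : Measure (Fin n → ℝ)))) =
          ε k * inner ℂ (g k) (b i : Lp ℂ 2 (volume : Measure (Fin n → ℝ))) := by
        rw [← U.inner_map_map (g k) (b i), hU, inner_smul_left, ← mul_assoc]
        rcases hε k with h | h <;> simp [h]
      have h2 : ε k * ε k = 1 := by rcases hε k with h | h <;> simp [h]
      rw [h1, ← inner_conj_symm (g k)]
      have h3 := RCLike.mul_conj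
        (inner ℂ (b i : Lp ℂ 2 (volume : Measure (Fin n → ℝ))) (g k) : ℂ)
      push_cast
      simp only [Complex.coe_algebraMap] at h3
      linear_combination (inner ℂ (b i : Lp ℂ 2 (volume : Measure (Fin n → ℝ))) (g k) : ℂ) *
        conj (inner ℂ (b i : Lp ℂ 2 (volume : Measure (Fin n → ℝ))) (g k) : ℂ) * (-h2) - h3
    have hge : ∀ i, ∑ k ∈ A, ‖(inner ℂ (b i : Lp ℂ 2 (volume : Measure (Fin n → ℝ)))
        (g k) : ℂ)‖ ^ 2 ≤ ‖∫ x, conj ((b i : Lp ℂ 2 (volume : Measure (Fin n → ℝ))) x) *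
          ∫ y, κ x y * U (b i : Lp ℂ 2 (volume : Measure (Fin n → ℝ))) y‖ := by
      intro i
      have h1 := Complex.hasSum_re (hval i)
      simp only [Complex.ofReal_re] at h1
      exact (sum_le_hasSum A (fun k _ => sq_nonneg _) h1).trans (Complex.re_le_norm _)
    have hA : ∀ k ∈ A, ∑ i, ‖(inner ℂ (b i : Lp ℂ 2 (volume : Measure (Fin n → ℝ)))
        (g k) : ℂ)‖ ^ 2 = ‖g k‖ ^ 2 := by
      intro k hk
      have hmem : g k ∈ E := Submodule.subset_span (by simpa using ⟨k, hk, rfl⟩)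
      exact b.sum_sq_norm_inner_right ⟨g k, hmem⟩
    rw [← ENNReal.ofReal_sum_of_nonneg fun k _ => sq_nonneg _, ← Finset.sum_congr rfl hA,
      Finset.sum_comm]
    calc _ ≤ ENNReal.ofReal (∑ i, ‖∫ x, conj ((b i : Lp ℂ 2 (volume : Measure (Fin n → ℝ))) x) *
          ∫ y, κ x y * U (b i : Lp ℂ 2 (volume : Measure (Fin n → ℝ))) y‖) :=
          ENNReal.ofReal_le_ofReal (Finset.sum_le_sum fun i _ => hge i)
      _ = _ := by
          rw [ENNReal.ofReal_sum_of_nonneg fun i _ => norm_nonneg _]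
          simp only [ofReal_norm]

end TraceNorm

section Kernel

variable {n : ℕ} {K : Type*} [Countable K]

theorem integral_norm_sq_eq_norm_sq (f : Lp ℂ 2 (volume : Measure (Fin n → ℝ))) :
    ∫ x, ‖f x‖ ^ 2 = ‖f‖ ^ 2 := by
  have h := L2.inner_def (𝕜 := ℂ) f f
  rw [inner_self_eq_norm_sq_to_K] at h
  have h2 : ∀ x, inner ℂ (f x) (f x) = ((‖f x‖ ^ 2 : ℝ) : ℂ) := by
    intro x; rw [inner_self_eq_norm_sq_to_K]; push_cast; rfl
  simp only [h2] at h
  rw [integral_complex_ofReal] at h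
  have h3 : ((‖f‖ ^ 2 : ℝ) : ℂ) = ((∫ x, ‖f x‖ ^ 2 : ℝ) : ℂ) := by
    rw [← h]; push_cast; rfl
  exact_mod_cast h3.symm

/-- The matrix elements of an integral operator whose kernel is a convergent sum of kernels of
rank one. -/
theorem hasSum_integral_kernel {κ : (Fin n → ℝ) → (Fin n → ℝ) → ℂ} {G : K → (Fin n → ℝ) → ℝ}
    {g : K → Lp ℂ 2 (volume : Measure (Fin n → ℝ))} {ε : K → ℂ} (hε : ∀ k, ‖ε k‖ = 1)
    (hg : ∀ k, g k =ᵐ[volume] fun x => (G k x : ℂ)) (hsum : Summable fun k => ‖g k‖ ^ 2)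
    (hG : ∀ x, Summable fun k => G k x ^ 2)
    (hκ : ∀ x y, HasSum (fun k => ε k * (G k x * G k y)) (κ x y))
    (e f : Lp ℂ 2 (volume : Measure (Fin n → ℝ))) :
    HasSum (fun k => ε k * (inner ℂ e (g k) * inner ℂ (g k) f))
      (∫ x, conj (e x) * ∫ y, κ x y * f y) := by
  have hLp : ∀ k, MemLp (fun x => (G k x : ℂ)) 2 volume := fun k =>
    (memLp_congr_ae (hg k)).1 (Lp.memLp (g k))
  have hGint : ∀ k, Integrable (fun x => G k x ^ 2) volume := by
    intro k
    have := (hLp k).integrable_norm_pow (p := 2) (by norm_num)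
    simpa using this
  have hGnorm : ∀ k, ∫ x, G k x ^ 2 = ‖g k‖ ^ 2 := by
    intro k
    rw [← integral_norm_sq_eq_norm_sq]
    refine integral_congr_ae ?_
    filter_upwards [hg k] with x hx
    simp [hx]
  have hLint : ∀ v : Lp ℂ 2 (volume : Measure (Fin n → ℝ)), Integrable (fun x => ‖v x‖ ^ 2) volume :=
    fun v => by simpa using (Lp.memLp v).integrable_norm_pow (p := 2) (by norm_num)
  have hinner_f : ∀ k, ∫ y, (G k y : ℂ) * f y = inner ℂ (g k) f := by
    intro k
    rw [L2.inner_def]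
    refine integral_congr_ae ?_
    filter_upwards [hg k] with x hx
    rw [RCLike.inner_apply, hx]
    simp [mul_comm]
  have hinner_e : ∀ k, ∫ x, conj (e x) * (G k x : ℂ) = inner ℂ e (g k) := by
    intro k
    rw [L2.inner_def]
    refine integral_congr_ae ?_
    filter_upwards [hg k] with x hx
    rw [RCLike.inner_apply, hx, mul_comm]
  have hint_f : ∀ k, Integrable (fun y => (G k y : ℂ) * f y) volume :=
    fun k => (hLp k).integrable_mul (Lp.memLp f)
  have hint_e : ∀ k, Integrable (fun x => conj (e x) * (G k x : ℂ)) volume :=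
    fun k => (Lp.memLp e).star.integrable_mul (hLp k)
  -- The exchange of sum and integral in `y` is dominated by `(G k y ² + G k x ² ‖f y‖²) / 2`, whose
  -- integrals are summable in `k` at each fixed `x`.
  have hin : ∀ x, ∫ y, κ x y * f y = ∑' k, ε k * G k x * inner ℂ (g k) f := by
    intro x
    have hs : Summable fun k => ∫ y, ‖ε k * G k x * ((G k y : ℂ) * f y)‖ := by
      refine Summable.of_nonneg_of_le (fun k => integral_nonneg fun y => norm_nonneg _) (fun k => ?_)
        ((hsum.add ((hG x).mul_right (‖f‖ ^ 2))).div_const 2)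
      have h1 : ∫ y, (G k y ^ 2 + G k x ^ 2 * ‖f y‖ ^ 2) / 2 =
          (‖g k‖ ^ 2 + G k x ^ 2 * ‖f‖ ^ 2) / 2 := by
        rw [integral_div, integral_add (hGint k) ((hLint f).const_mul _), integral_const_mul,
          hGnorm, integral_norm_sq_eq_norm_sq]
      rw [← h1]
      refine integral_mono ((hint_f k).const_mul _).norm
        (((hGint k).add ((hLint f).const_mul _)).div_const 2) fun y => ?_
      simp only [norm_mul, hε, one_mul, Complex.norm_real, Real.norm_eq_abs]
      nlinarith [sq_nonneg (|G k y| - |G k x| * ‖f y‖), sq_abs (G k y), sq_abs (G k x)]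
    have := hasSum_integral_of_summable_integral_norm (fun k => (hint_f k).const_mul _) hs
    calc ∫ y, κ x y * f y
        = ∫ y, ∑' k, ε k * G k x * ((G k y : ℂ) * f y) := by
          refine integral_congr_ae (Filter.Eventually.of_forall fun y => ?_)
          simp only
          rw [← ((hκ x y).mul_right (f y)).tsum_eq]
          exact tsum_congr fun k => by ring
      _ = ∑' k, ∫ y, ε k * G k x * ((G k y : ℂ) * f y) := this.tsum_eq.symm
      _ = _ := by
          refine tsum_congr fun k => ?_
          rw [integral_const_mul, hinner_f]
  have hcauchy : ∀ k, ‖(inner ℂ (g k) f : ℂ)‖ ^ 2 ≤ ‖g k‖ ^ 2 * ‖f‖ ^ 2 := by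
    intro k
    rw [← mul_pow]
    gcongr
    exact norm_inner_le_norm _ _
  have hinsum : ∀ x, Summable fun k => ε k * G k x * inner ℂ (g k) f := by
    intro x
    refine Summable.of_norm_bounded
      (((hG x).add (hsum.mul_right (‖f‖ ^ 2))).div_const 2) fun k => ?_
    simp only [norm_mul, hε, one_mul, Complex.norm_real, Real.norm_eq_abs]
    nlinarith [sq_nonneg (|G k x| - ‖(inner ℂ (g k) f : ℂ)‖), sq_abs (G k x), hcauchy k]
  -- The same domination for the integral in `x`, with `⟨g k, f⟩` controlled by Cauchy–Schwarz.
  have hs : Summable fun k => ∫ x, ‖ε k * inner ℂ (g k) f * (conj (e x) * (G k x : ℂ))‖ := by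
    refine Summable.of_nonneg_of_le (fun k => integral_nonneg fun y => norm_nonneg _) (fun k => ?_)
      ((hsum.add ((hsum.mul_right (‖f‖ ^ 2)).mul_right (‖e‖ ^ 2))).div_const 2)
    have h1 : ∫ x, (G k x ^ 2 + ‖(inner ℂ (g k) f : ℂ)‖ ^ 2 * ‖e x‖ ^ 2) / 2 =
        (‖g k‖ ^ 2 + ‖(inner ℂ (g k) f : ℂ)‖ ^ 2 * ‖e‖ ^ 2) / 2 := by
      rw [integral_div, integral_add (hGint k) ((hLint e).const_mul _), integral_const_mul,
        hGnorm, integral_norm_sq_eq_norm_sq]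
    have h2 : (‖g k‖ ^ 2 + ‖(inner ℂ (g k) f : ℂ)‖ ^ 2 * ‖e‖ ^ 2) / 2 ≤
        (‖g k‖ ^ 2 + ‖g k‖ ^ 2 * ‖f‖ ^ 2 * ‖e‖ ^ 2) / 2 := by
      gcongr
      exact hcauchy k
    refine le_trans ?_ h2
    rw [← h1]
    refine integral_mono ((hint_e k).const_mul _).norm
      (((hGint k).add ((hLint e).const_mul _)).div_const 2) fun x => ?_
    simp only [norm_mul, hε, one_mul, Complex.norm_real, Real.norm_eq_abs, RCLike.norm_conj]
    nlinarith [sq_nonneg (|G k x| - ‖(inner ℂ (g k) f : ℂ)‖ * ‖e x‖), sq_abs (G k x)]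
  have := hasSum_integral_of_summable_integral_norm (fun k => (hint_e k).const_mul _) hs
  have e1 : ∀ k, ε k * (inner ℂ e (g k) * inner ℂ (g k) f) =
      ∫ x, ε k * inner ℂ (g k) f * (conj (e x) * (G k x : ℂ)) := by
    intro k
    rw [integral_const_mul, hinner_e]; ring
  have e2 : ∀ x, (conj (e x) * ∫ y, κ x y * f y) =
      ∑' k, ε k * inner ℂ (g k) f * (conj (e x) * (G k x : ℂ)) := by
    intro x
    rw [hin, ← (hinsum x).tsum_mul_left]
    exact tsum_congr fun k => by ring
  simp only [e1, e2]
  exact this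

end Kernel

end HarmonicChain

/-! ### Gaussian integrals and the Mehler kernel -/

namespace HarmonicChain

open MeasureTheory Matrix

section GaussianIntegral

variable {n : ℕ}

theorem integrable_integral_gaussian {L : Matrix (Fin n) (Fin n) ℝ} (hL : L.det ≠ 0)
    {a : Fin n → ℝ} (ha : ∀ j, 0 < a j) :
    Integrable (fun x : Fin n → ℝ => Real.exp (-∑ j, a j * (L *ᵥ x) j ^ 2)) ∧
      ∫ x : Fin n → ℝ, Real.exp (-∑ j, a j * (L *ᵥ x) j ^ 2) =
        |L.det⁻¹| * ∏ j, √(Real.pi / a j) := by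
  have hfun : ∀ u : Fin n → ℝ, Real.exp (-∑ j, a j * u j ^ 2) =
      ∏ j, Real.exp (-a j * u j ^ 2) := by
    intro u
    rw [← Real.exp_sum, ← Finset.sum_neg_distrib]
    simp only [neg_mul]
  have hint : Integrable fun u : Fin n → ℝ => Real.exp (-∑ j, a j * u j ^ 2) := by
    simp only [hfun]
    exact Integrable.fintype_prod (f := fun j (t : ℝ) => Real.exp (-a j * t ^ 2))
      fun j => integrable_exp_neg_mul_sq (ha j)
  have hval : ∫ u : Fin n → ℝ, Real.exp (-∑ j, a j * u j ^ 2) = ∏ j, √(Real.pi / a j) := by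
    simp only [hfun]
    rw [integral_fintype_prod_volume_eq_prod (fun j (t : ℝ) => Real.exp (-a j * t ^ 2))]
    exact Finset.prod_congr rfl fun j _ => integral_gaussian (a j)
  have hmap := Real.map_matrix_volume_pi_eq_smul_volume_pi hL
  have hcont : Continuous (toLin' L) := LinearMap.continuous_on_pi _
  have hmeas : AEMeasurable (toLin' L) (volume : Measure (Fin n → ℝ)) :=
    hcont.measurable.aemeasurable
  have hcont' : Continuous fun u : Fin n → ℝ => Real.exp (-∑ j, a j * u j ^ 2) := by fun_prop
  constructor
  · have h1 : Integrable (fun u : Fin n → ℝ => Real.exp (-∑ j, a j * u j ^ 2))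
        (Measure.map (toLin' L) volume) := by
      rw [hmap]; exact hint.smul_measure ENNReal.ofReal_ne_top
    exact (integrable_map_measure hcont'.aestronglyMeasurable hmeas).1 h1
  · have h1 := integral_map hmeas (f := fun u : Fin n → ℝ => Real.exp (-∑ j, a j * u j ^ 2))
      hcont'.aestronglyMeasurable
    rw [hmap, integral_smul_measure, hval, ENNReal.toReal_ofReal (abs_nonneg _), smul_eq_mul] at h1
    rw [h1]
    rfl

end GaussianIntegral

/-- Summing over words `Fin p → Fin n` instead of multi-indices keeps the coefficient `1 / p!` and
makes every term a plain product. Absolute summability is the same expansion for `|a j|`. -/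
theorem hasSum_exp_sum {n : ℕ} (a : Fin n → ℝ) :
    HasSum (fun k : Σ p : ℕ, (Fin p → Fin n) => (∏ q, a (k.2 q)) / (k.1.factorial : ℝ))
      (Real.exp (∑ j, a j)) := by
  have hfib : ∀ (a : Fin n → ℝ) (p : ℕ), HasSum (fun σ : Fin p → Fin n =>
      (∏ q, a (σ q)) / (p.factorial : ℝ)) ((∑ j, a j) ^ p / p.factorial) := by
    intro a p
    rw [Fintype.sum_pow, Finset.sum_div]
    exact hasSum_fintype _
  have hexp : ∀ t : ℝ, HasSum (fun p : ℕ => t ^ p / p.factorial) (Real.exp t) := by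
    intro t
    rw [Real.exp_eq_exp_ℝ]
    exact NormedSpace.expSeries_div_hasSum_exp t
  refine HasSum.sigma_of_hasSum (hexp _) (fun p => hfib a p) ?_
  rw [← summable_norm_iff]
  have heq : ∀ k : Σ p : ℕ, (Fin p → Fin n), ‖(∏ q, a (k.2 q)) / (k.1.factorial : ℝ)‖ =
      (∏ q, |a (k.2 q)|) / (k.1.factorial : ℝ) := by
    intro k
    rw [norm_div, Real.norm_natCast, norm_prod]
    rfl
  simp only [heq]
  rw [summable_sigma_of_nonneg fun k => div_nonneg (Finset.prod_nonneg fun q _ => abs_nonneg _)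
    (Nat.cast_nonneg _)]
  refine ⟨fun p => (hfib (fun j => |a j|) p).summable, ?_⟩
  refine (hexp (∑ j, |a j|)).summable.congr fun p => ?_
  exact (hfib (fun j => |a j|) p).tsum_eq.symm

section MehlerKernel

variable {n : ℕ}

/-- The sign by which the coefficient `b` of a bilinear exponent acts. -/
noncomputable def mehlerSign (b : ℝ) : ℝ := if b ≤ 0 then 1 else -1

/-- This needs the value `1`, not `0`, at `b = 0`; it makes the reflection an involution. -/
theorem mehlerSign_mul_self (b : ℝ) : mehlerSign b * mehlerSign b = 1 := by
  unfold mehlerSign; split_ifs <;> norm_num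

theorem mehlerSign_mul_abs (b : ℝ) : mehlerSign b * |b| = -b := by
  unfold mehlerSign; split_ifs with h
  · rw [abs_of_nonpos h, one_mul]
  · rw [abs_of_pos (not_le.1 h)]; ring

/-- The functions whose rank one kernels sum up to the Mehler kernel, in the coordinates `L x`. -/
noncomputable def mehlerFunction (L : Matrix (Fin n) (Fin n) ℝ) (C : ℝ) (d b : Fin n → ℝ)
    (k : Σ p : ℕ, (Fin p → Fin n)) (x : Fin n → ℝ) : ℝ :=
  √(C / k.1.factorial) * (∏ q, (√|b (k.2 q)| * (L *ᵥ x) (k.2 q))) *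
    Real.exp (-(∑ j, d j * (L *ᵥ x) j ^ 2) / 2)

theorem mehlerFunction_mul (L : Matrix (Fin n) (Fin n) ℝ) {C : ℝ} (hC : 0 ≤ C) (d b : Fin n → ℝ)
    (k : Σ p : ℕ, (Fin p → Fin n)) (x y : Fin n → ℝ) :
    mehlerFunction L C d b k x * mehlerFunction L C d b k y =
      C * Real.exp (-(∑ j, d j * (L *ᵥ x) j ^ 2) / 2 - (∑ j, d j * (L *ᵥ y) j ^ 2) / 2) *
        ((∏ q, (|b (k.2 q)| * (L *ᵥ x) (k.2 q) * (L *ᵥ y) (k.2 q))) / k.1.factorial) := by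
  have h1 : √(C / k.1.factorial) * √(C / k.1.factorial) = C / k.1.factorial :=
    Real.mul_self_sqrt (div_nonneg hC (Nat.cast_nonneg _))
  have h2 : (∏ q, (√|b (k.2 q)| * (L *ᵥ x) (k.2 q))) * ∏ q, (√|b (k.2 q)| * (L *ᵥ y) (k.2 q)) =
      ∏ q, (|b (k.2 q)| * (L *ᵥ x) (k.2 q) * (L *ᵥ y) (k.2 q)) := by
    rw [← Finset.prod_mul_distrib]
    refine Finset.prod_congr rfl fun q _ => ?_
    linear_combination ((L *ᵥ x) (k.2 q) * (L *ᵥ y) (k.2 q)) *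
      Real.mul_self_sqrt (abs_nonneg (b (k.2 q)))
  rw [sub_eq_add_neg, Real.exp_add, ← neg_div, ← h2]
  unfold mehlerFunction
  linear_combination ((∏ q, (√|b (k.2 q)| * (L *ᵥ x) (k.2 q))) *
    (∏ q, (√|b (k.2 q)| * (L *ᵥ y) (k.2 q))) * Real.exp (-(∑ j, d j * (L *ᵥ x) j ^ 2) / 2) *
    Real.exp (-(∑ j, d j * (L *ᵥ y) j ^ 2) / 2)) * h1

theorem hasSum_mehlerFunction (L : Matrix (Fin n) (Fin n) ℝ) {C : ℝ} (hC : 0 ≤ C)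
    (d b : Fin n → ℝ) (x y : Fin n → ℝ) :
    HasSum (fun k => (∏ q, mehlerSign (b (k.2 q))) *
      (mehlerFunction L C d b k x * mehlerFunction L C d b k y))
      (C * Real.exp (-(∑ j, d j * (L *ᵥ x) j ^ 2) / 2 - (∑ j, d j * (L *ᵥ y) j ^ 2) / 2 -
        ∑ j, b j * (L *ᵥ x) j * (L *ᵥ y) j)) := by
  have h := (hasSum_exp_sum fun j => -(b j * (L *ᵥ x) j * (L *ᵥ y) j)).mul_left
    (C * Real.exp (-(∑ j, d j * (L *ᵥ x) j ^ 2) / 2 - (∑ j, d j * (L *ᵥ y) j ^ 2) / 2))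
  rw [Finset.sum_neg_distrib, mul_assoc, ← Real.exp_add, ← sub_eq_add_neg] at h
  refine h.congr_fun fun k => ?_
  rw [mehlerFunction_mul L hC, mul_left_comm, ← mul_div_assoc, ← Finset.prod_mul_distrib]
  congr 2
  refine Finset.prod_congr rfl fun q _ => ?_
  linear_combination ((L *ᵥ x) (k.2 q) * (L *ᵥ y) (k.2 q)) * mehlerSign_mul_abs (b (k.2 q))

/-- Without the signs the cross term on the diagonal is `+∑ |b| u²`, which weakens the exponent `d`
to `d - |b|`. The integral of this is the trace norm. -/
theorem hasSum_mehlerFunction_sq (L : Matrix (Fin n) (Fin n) ℝ) {C : ℝ} (hC : 0 ≤ C)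
    (d b : Fin n → ℝ) (x : Fin n → ℝ) :
    HasSum (fun k => mehlerFunction L C d b k x ^ 2)
      (C * Real.exp (-∑ j, (d j - |b j|) * (L *ᵥ x) j ^ 2)) := by
  have h := (hasSum_exp_sum fun j => |b j| * (L *ᵥ x) j * (L *ᵥ x) j).mul_left
    (C * Real.exp (-(∑ j, d j * (L *ᵥ x) j ^ 2) / 2 - (∑ j, d j * (L *ᵥ x) j ^ 2) / 2))
  have hexp : -(∑ j, d j * (L *ᵥ x) j ^ 2) / 2 - (∑ j, d j * (L *ᵥ x) j ^ 2) / 2 +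
      ∑ j, |b j| * (L *ᵥ x) j * (L *ᵥ x) j = -∑ j, (d j - |b j|) * (L *ᵥ x) j ^ 2 := by
    have : ∑ j, (d j - |b j|) * (L *ᵥ x) j ^ 2 =
        ∑ j, d j * (L *ᵥ x) j ^ 2 - ∑ j, |b j| * (L *ᵥ x) j * (L *ᵥ x) j := by
      rw [← Finset.sum_sub_distrib]
      exact Finset.sum_congr rfl fun j _ => by ring
    rw [this]; ring
  rw [mul_assoc, ← Real.exp_add, hexp] at h
  refine h.congr_fun fun k => ?_
  rw [sq, mehlerFunction_mul L hC]

theorem continuous_mehlerFunction (L : Matrix (Fin n) (Fin n) ℝ) (C : ℝ) (d b : Fin n → ℝ)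
    (k : Σ p : ℕ, (Fin p → Fin n)) : Continuous (mehlerFunction L C d b k) := by
  have h : ∀ j, Continuous fun x : Fin n → ℝ => (L *ᵥ x) j := fun j =>
    (continuous_apply j).comp (LinearMap.continuous_on_pi (toLin' L))
  unfold mehlerFunction
  fun_prop

/-- The reflection that changes the sign of the coordinates `(L x) j` with `0 < b j`. -/
noncomputable def mehlerReflection (L : Matrix (Fin n) (Fin n) ℝ) (b : Fin n → ℝ) :
    Matrix (Fin n) (Fin n) ℝ :=
  L⁻¹ * diagonal (fun j => mehlerSign (b j)) * L

theorem mulVec_mehlerReflection {L : Matrix (Fin n) (Fin n) ℝ} (hL : L.det ≠ 0) (b x : Fin n → ℝ)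
    (j : Fin n) : (L *ᵥ (mehlerReflection L b *ᵥ x)) j = mehlerSign (b j) * (L *ᵥ x) j := by
  rw [mulVec_mulVec, mehlerReflection, ← Matrix.mul_assoc, ← Matrix.mul_assoc,
    mul_nonsing_inv L (isUnit_iff_ne_zero.2 hL), Matrix.one_mul, ← mulVec_mulVec, mulVec_diagonal]

theorem abs_det_mehlerReflection {L : Matrix (Fin n) (Fin n) ℝ} (hL : L.det ≠ 0) (b : Fin n → ℝ) :
    |(mehlerReflection L b).det| = 1 := by
  have h1 : ∀ j, |mehlerSign (b j)| = 1 := by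
    intro j; unfold mehlerSign; split_ifs <;> simp
  rw [mehlerReflection, det_mul, det_mul, mul_right_comm, det_nonsing_inv, Ring.inverse_eq_inv',
    inv_mul_cancel₀ hL, one_mul, det_diagonal, Finset.abs_prod]
  simp [h1]

/-- The reflection may be oblique, since `L` need not be orthogonal, but its determinant is `±1`; so
composition with it is an isometry of `L²`. -/
theorem measurePreserving_mehlerReflection {L : Matrix (Fin n) (Fin n) ℝ} (hL : L.det ≠ 0)
    (b : Fin n → ℝ) : MeasurePreserving (fun x => mehlerReflection L b *ᵥ x)
      (volume : Measure (Fin n → ℝ)) volume := by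
  have h1 := abs_det_mehlerReflection hL b
  refine ⟨(LinearMap.continuous_on_pi (toLin' (mehlerReflection L b))).measurable, ?_⟩
  have h2 := Real.map_matrix_volume_pi_eq_smul_volume_pi (M := mehlerReflection L b)
    (by intro h0; simp [h0] at h1)
  rw [abs_inv, h1, inv_one, ENNReal.ofReal_one, one_smul] at h2
  exact h2

/-- The Gaussian factor is even in each coordinate and each letter of the word contributes its sign,
so the eigenvalue is the very sign of this term in the expansion of the kernel. -/
theorem mehlerFunction_reflection {L : Matrix (Fin n) (Fin n) ℝ} (hL : L.det ≠ 0) (C : ℝ)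
    (d b : Fin n → ℝ) (k : Σ p : ℕ, (Fin p → Fin n)) (x : Fin n → ℝ) :
    mehlerFunction L C d b k (mehlerReflection L b *ᵥ x) =
      (∏ q, mehlerSign (b (k.2 q))) * mehlerFunction L C d b k x := by
  unfold mehlerFunction
  simp only [mulVec_mehlerReflection hL, mul_pow]
  have h1 : ∀ j, mehlerSign (b j) ^ 2 = 1 := fun j => by rw [sq, mehlerSign_mul_self]
  simp only [h1, one_mul]
  rw [show (∏ q, (√|b (k.2 q)| * (mehlerSign (b (k.2 q)) * (L *ᵥ x) (k.2 q)))) =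
      (∏ q, mehlerSign (b (k.2 q))) * ∏ q, (√|b (k.2 q)| * (L *ᵥ x) (k.2 q)) by
    rw [← Finset.prod_mul_distrib]; exact Finset.prod_congr rfl fun q _ => by ring]
  ring

/-- The trace norm of a Mehler kernel. -/
theorem traceNorm_mehler {L : Matrix (Fin n) (Fin n) ℝ} (hL : L.det ≠ 0) {C : ℝ} (hC : 0 ≤ C)
    {d b : Fin n → ℝ} (hbd : ∀ j, |b j| < d j) :
    traceNorm (fun x y : Fin n → ℝ => ((C * Real.exp (-(∑ j, d j * (L *ᵥ x) j ^ 2) / 2 -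
      (∑ j, d j * (L *ᵥ y) j ^ 2) / 2 - ∑ j, b j * (L *ᵥ x) j * (L *ᵥ y) j) : ℝ) : ℂ)) =
      ENNReal.ofReal (C * (|L.det⁻¹| * ∏ j, √(Real.pi / (d j - |b j|)))) := by
  set G := mehlerFunction L C d b with hG
  obtain ⟨hint, hval⟩ := integrable_integral_gaussian hL (a := fun j => d j - |b j|)
    fun j => sub_pos.2 (hbd j)
  have hGsq := hasSum_mehlerFunction_sq L hC d b
  have hGcont := continuous_mehlerFunction L C d b
  have hle : ∀ k x, G k x ^ 2 ≤ C * Real.exp (-∑ j, (d j - |b j|) * (L *ᵥ x) j ^ 2) :=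
    fun k x => le_hasSum (hGsq x) k fun l _ => sq_nonneg _
  have hGint : ∀ k, Integrable (fun x => G k x ^ 2) := by
    intro k
    refine (hint.const_mul C).mono' ((hGcont k).pow 2).aestronglyMeasurable
      (Filter.Eventually.of_forall fun x => ?_)
    rw [Real.norm_of_nonneg (sq_nonneg _)]
    exact hle k x
  have hLp : ∀ k, MemLp (fun x => (G k x : ℂ)) 2 volume := by
    intro k
    refine (memLp_two_iff_integrable_sq_norm
      (Complex.continuous_ofReal.comp (hGcont k)).aestronglyMeasurable).2 ?_
    simpa using hGint k
  set g : (Σ p : ℕ, (Fin p → Fin n)) → Lp ℂ 2 (volume : Measure (Fin n → ℝ)) :=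
    fun k => (hLp k).toLp _ with hgdef
  have hg : ∀ k, g k =ᵐ[volume] fun x => (G k x : ℂ) := fun k => (hLp k).coeFn_toLp
  have hgnorm : ∀ k, ‖g k‖ ^ 2 = ∫ x, G k x ^ 2 := by
    intro k
    rw [← integral_norm_sq_eq_norm_sq]
    refine integral_congr_ae ?_
    filter_upwards [hg k] with x hx
    simp [hx]
  -- Tonelli in `ℝ≥0∞` yields both the summability of `‖g k‖²` and its sum.
  have hENN : ∑' k, ENNReal.ofReal (‖g k‖ ^ 2) =
      ENNReal.ofReal (∫ x, C * Real.exp (-∑ j, (d j - |b j|) * (L *ᵥ x) j ^ 2)) := by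
    rw [ofReal_integral_eq_lintegral_ofReal (hint.const_mul C)
      (Filter.Eventually.of_forall fun x => mul_nonneg hC (Real.exp_pos _).le)]
    have h1 : ∀ x, ENNReal.ofReal (C * Real.exp (-∑ j, (d j - |b j|) * (L *ᵥ x) j ^ 2)) =
        ∑' k, ENNReal.ofReal (G k x ^ 2) := by
      intro x
      rw [← (hGsq x).tsum_eq, ENNReal.ofReal_tsum_of_nonneg (fun k => sq_nonneg _) (hGsq x).summable]
    simp only [h1]
    rw [lintegral_tsum (f := fun k x => ENNReal.ofReal (G k x ^ 2)) fun k =>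
      (((hGcont k).pow 2).measurable.ennreal_ofReal).aemeasurable]
    refine tsum_congr fun k => ?_
    rw [hgnorm, ofReal_integral_eq_lintegral_ofReal (hGint k)
      (Filter.Eventually.of_forall fun x => sq_nonneg _)]
  have hsum : Summable fun k => ‖g k‖ ^ 2 := by
    have h1 : ∑' k, ENNReal.ofReal (‖g k‖ ^ 2) ≠ ⊤ := by rw [hENN]; exact ENNReal.ofReal_ne_top
    have h2 := ENNReal.summable_toReal h1
    simpa [ENNReal.toReal_ofReal, sq_nonneg] using h2
  have hsign : ∀ k : Σ p : ℕ, (Fin p → Fin n),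
      (((∏ q, mehlerSign (b (k.2 q)) : ℝ)) : ℂ) = 1 ∨
        (((∏ q, mehlerSign (b (k.2 q)) : ℝ)) : ℂ) = -1 := by
    intro k
    have h1 : (∏ q, mehlerSign (b (k.2 q))) * (∏ q, mehlerSign (b (k.2 q))) = 1 := by
      rw [← Finset.prod_mul_distrib]
      exact Finset.prod_eq_one fun q _ => mehlerSign_mul_self _
    rcases mul_self_eq_one_iff.1 h1 with h | h
    · left; rw [h]; simp
    · right; rw [h]; simp
  have hmp := measurePreserving_mehlerReflection hL b
  rw [traceNorm_eq_tsum (g := g) hsign hsum (Lp.compMeasurePreservingₗᵢ ℂ _ hmp)]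
  · rw [ENNReal.ofReal_tsum_of_nonneg (fun k => sq_nonneg _) hsum, hENN, integral_const_mul, hval]
  · intro k
    apply Lp.ext
    have h1 : (Lp.compMeasurePreservingₗᵢ ℂ _ hmp (g k) : (Fin n → ℝ) → ℂ) =ᵐ[volume]
        (g k) ∘ fun x => mehlerReflection L b *ᵥ x := Lp.coeFn_compMeasurePreserving (g k) hmp
    have h2 := hmp.quasiMeasurePreserving.ae_eq_comp (hg k)
    have h3 := Lp.coeFn_smul (((∏ q, mehlerSign (b (k.2 q)) : ℝ)) : ℂ) (g k)
    filter_upwards [h1, h2, h3, hg k] with x hx1 hx2 hx3 hx4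
    rw [hx1, hx2, hx3, Pi.smul_apply, hx4]
    simp only [Function.comp_apply, hG, mehlerFunction_reflection hL]
    push_cast
    rfl
  · intro e f
    refine hasSum_integral_kernel (G := G) (fun k => ?_) hg hsum (fun x => (hGsq x).summable)
      (fun x y => ?_) e f
    · rcases hsign k with h | h <;> simp [h]
    · have := Complex.hasSum_ofReal.2 (hasSum_mehlerFunction L hC d b x y)
      simpa only [Complex.ofReal_mul] using this

end MehlerKernel

end HarmonicChain

/-! ### Gaussians as Schwartz functions -/

namespace HarmonicChain

open MeasureTheory Matrix

variable {n : ℕ}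

section Gaussian

/-- The coordinate `(S x) j` as a continuous linear functional. -/
noncomputable def mulVecCLM (S : Matrix (Fin n) (Fin n) ℝ) (j : Fin n) : (Fin n → ℝ) →L[ℝ] ℝ :=
  (ContinuousLinearMap.proj j).comp (LinearMap.toContinuousLinearMap (toLin' S))

@[simp]
theorem mulVecCLM_apply (S : Matrix (Fin n) (Fin n) ℝ) (j : Fin n) (x : Fin n → ℝ) :
    mulVecCLM S j x = (S *ᵥ x) j := rfl

theorem mulVecCLM_single (S : Matrix (Fin n) (Fin n) ℝ) (i j : Fin n) :
    mulVecCLM S i (Pi.single j 1) = S i j := by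
  simp

theorem exists_hasFDerivAt_quadratic {S : Matrix (Fin n) (Fin n) ℝ} (hS : S.IsSymm)
    (x : Fin n → ℝ) : ∃ D : (Fin n → ℝ) →L[ℝ] ℝ,
      HasFDerivAt (fun x : Fin n → ℝ => x ⬝ᵥ S *ᵥ x) D x ∧
        ∀ j, D (Pi.single j 1) = 2 * (S *ᵥ x) j := by
  have h1 : ∀ i ∈ (Finset.univ : Finset (Fin n)), HasFDerivAt
      (fun x : Fin n → ℝ => x i * (S *ᵥ x) i)
      (x i • mulVecCLM S i + (S *ᵥ x) i • ContinuousLinearMap.proj (R := ℝ) i) x := fun i _ =>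
    (ContinuousLinearMap.proj (R := ℝ) (φ := fun _ : Fin n => ℝ) i).hasFDerivAt.mul
      (mulVecCLM S i).hasFDerivAt
  have h2 := HasFDerivAt.fun_sum h1
  refine ⟨_, h2, fun j => ?_⟩
  simp only [_root_.sum_apply, _root_.add_apply,
    _root_.smul_apply, mulVecCLM_single, ContinuousLinearMap.proj_apply, smul_eq_mul]
  rw [Finset.sum_add_distrib]
  have h3 : ∑ i, x i * S i j = (S *ᵥ x) j := by
    simp only [mulVec, dotProduct]
    refine Finset.sum_congr rfl fun i _ => ?_
    rw [hS.apply, mul_comm]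
  rw [h3, Finset.sum_eq_single j]
  · simp; ring
  · intro b _ hb; simp [hb]
  · simp

theorem exists_pos_mul_norm_sq_le {S : Matrix (Fin n) (Fin n) ℝ} (hS : S.PosDef) :
    ∃ c > 0, ∀ x : Fin n → ℝ, c * ‖x‖ ^ 2 ≤ x ⬝ᵥ S *ᵥ x := by
  have hpos : ∀ x : Fin n → ℝ, x ≠ 0 → 0 < x ⬝ᵥ S *ᵥ x := by
    intro x hx
    simpa using hS.dotProduct_mulVec_pos hx
  have hcont : Continuous fun x : Fin n → ℝ => x ⬝ᵥ S *ᵥ x := by fun_prop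
  -- The sphere is empty when `n = 0`; otherwise `c` is the minimum of the form on it.
  rcases (Metric.sphere (0 : Fin n → ℝ) 1).eq_empty_or_nonempty with h | h
  · refine ⟨1, one_pos, fun x => ?_⟩
    have hx : x = 0 := by
      by_contra hx
      have : ‖x‖⁻¹ • x ∈ Metric.sphere (0 : Fin n → ℝ) 1 := by
        simp [norm_smul, norm_ne_zero_iff.2 hx]
      rw [h] at this
      exact this
    simp [hx]
  · obtain ⟨x₀, hx₀, hmin⟩ := (isCompact_sphere (0 : Fin n → ℝ) 1).exists_isMinOn h hcont.continuousOn
    have hx₀0 : x₀ ≠ 0 := by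
      rintro rfl; simp at hx₀
    refine ⟨x₀ ⬝ᵥ S *ᵥ x₀, hpos x₀ hx₀0, fun x => ?_⟩
    by_cases hx : x = 0
    · simp [hx]
    · have hn : ‖x‖ ≠ 0 := norm_ne_zero_iff.2 hx
      have hmem : ‖x‖⁻¹ • x ∈ Metric.sphere (0 : Fin n → ℝ) 1 := by
        simp [norm_smul, hn]
      have h1 := hmin hmem
      simp only [Set.mem_ofPred_eq, mulVec_smul, dotProduct_smul, smul_dotProduct, smul_eq_mul] at h1
      have h2 : x ⬝ᵥ S *ᵥ x = (‖x‖⁻¹ * (‖x‖⁻¹ * x ⬝ᵥ S *ᵥ x)) * ‖x‖ ^ 2 := by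
        field_simp
      rw [h2]
      gcongr

theorem one_add_pow_mul_exp_le (K : ℕ) {c : ℝ} (hc : 0 < c) :
    ∃ A, ∀ t : ℝ, 0 ≤ t → (1 + t) ^ K * Real.exp (-(c * t ^ 2)) ≤ A := by
  -- Combines `(1 + t)^K ≤ K! exp (1 + t)` with `t - c t² ≤ 1 / (4c)`, by completing the square.
  refine ⟨K.factorial * Real.exp (1 + 1 / (4 * c)), fun t ht => ?_⟩
  have h1 : (1 + t) ^ K ≤ K.factorial * Real.exp (1 + t) := by
    have := Real.pow_div_factorial_le_exp (1 + t) (by linarith) K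
    rwa [div_le_iff₀ (by positivity), mul_comm] at this
  have h2 : t - c * t ^ 2 ≤ 1 / (4 * c) := by
    rw [le_div_iff₀ (by positivity)]
    nlinarith [sq_nonneg (2 * c * t - 1)]
  calc (1 + t) ^ K * Real.exp (-(c * t ^ 2))
      ≤ K.factorial * Real.exp (1 + t) * Real.exp (-(c * t ^ 2)) := by gcongr
    _ = K.factorial * Real.exp (1 + t + -(c * t ^ 2)) := by rw [mul_assoc, ← Real.exp_add]
    _ ≤ _ := by
        refine mul_le_mul_of_nonneg_left (Real.exp_le_exp.2 ?_) (Nat.cast_nonneg _)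
        linarith

theorem hasTemperateGrowth_quadratic (S : Matrix (Fin n) (Fin n) ℝ) :
    Function.HasTemperateGrowth fun x : Fin n → ℝ => -(x ⬝ᵥ S *ᵥ x) / 2 := by
  have h1 : ∀ i, Function.HasTemperateGrowth fun x : Fin n → ℝ => x i * (S *ᵥ x) i := fun i =>
    (ContinuousLinearMap.proj (R := ℝ) (φ := fun _ : Fin n => ℝ) i).hasTemperateGrowth.mul
      (mulVecCLM S i).hasTemperateGrowth
  have h2 := (Function.HasTemperateGrowth.sum (s := Finset.univ) fun i _ => h1 i).mul
    (Function.HasTemperateGrowth.const (-(1 / 2) : ℝ))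
  have h3 : (fun x : Fin n → ℝ => -(x ⬝ᵥ S *ᵥ x) / 2) =
      (∑ i, (fun x : Fin n → ℝ => x i * (S *ᵥ x) i) ·) * fun _ => -(1 / 2) := by
    ext x
    simp only [dotProduct, Pi.mul_apply]
    ring
  rw [h3]
  exact h2

/-- The Gaussian `exp (-⟨x, S x⟩ / 2)` as a Schwartz function. -/
noncomputable def gaussianSchwartz {S : Matrix (Fin n) (Fin n) ℝ} (hS : S.PosDef) :
    𝓢(Fin n → ℝ, ℂ) :=
  SchwartzMap.postcompCLM (𝕜 := ℝ) Complex.ofRealCLM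
  { toFun := fun x => Real.exp (-(x ⬝ᵥ S *ᵥ x) / 2)
    smooth' := Real.contDiff_exp.comp (hasTemperateGrowth_quadratic S).1
    decay' := by
      intro k l
      obtain ⟨c, hc, hcS⟩ := exists_pos_mul_norm_sq_le hS
      obtain ⟨k', C, hC, hbound⟩ := (hasTemperateGrowth_quadratic S).norm_iteratedFDeriv_le_uniform l
      obtain ⟨A, hA⟩ := one_add_pow_mul_exp_le (k + k' * l) (half_pos hc)
      refine ⟨l.factorial * (1 + C) ^ l * A, fun x => ?_⟩
      -- The constant `1 + C` replaces `C` to make this base at least `1`, hence at most its `i`-th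
      -- power for `i ≥ 1`, as the bound on derivatives of a composition requires.
      have hD1 : 1 ≤ (1 + C) * (1 + ‖x‖) ^ k' := by
        have := one_le_pow₀ (n := k') (by linarith [norm_nonneg x] : 1 ≤ 1 + ‖x‖)
        nlinarith
      have h1 := norm_iteratedFDeriv_comp_le (𝕜 := ℝ) (g := Real.exp)
        (f := fun x : Fin n → ℝ => -(x ⬝ᵥ S *ᵥ x) / 2) (n := l) (N := l) Real.contDiff_exp
        ((hasTemperateGrowth_quadratic S).1.of_le (by exact_mod_cast le_top)) le_rfl x
        (C := Real.exp (-(x ⬝ᵥ S *ᵥ x) / 2)) (D := (1 + C) * (1 + ‖x‖) ^ k')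
        (fun i _ => by
          rw [norm_iteratedFDeriv_eq_norm_iteratedDeriv, iteratedDeriv_eq_iterate,
            Real.iter_deriv_exp, Real.norm_of_nonneg (Real.exp_pos _).le])
        (fun i hi hil => by
          refine (hbound i hil x).trans ?_
          calc C * (1 + ‖x‖) ^ k' ≤ (1 + C) * (1 + ‖x‖) ^ k' := by gcongr; linarith
            _ ≤ _ := le_self_pow₀ hD1 (by omega))
      have h2 : Real.exp (-(x ⬝ᵥ S *ᵥ x) / 2) ≤ Real.exp (-(c / 2 * ‖x‖ ^ 2)) := by
        apply Real.exp_le_exp.2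
        linarith [hcS x]
      calc ‖x‖ ^ k * ‖iteratedFDeriv ℝ l (fun x : Fin n → ℝ => Real.exp (-(x ⬝ᵥ S *ᵥ x) / 2)) x‖
          ≤ (1 + ‖x‖) ^ k * (l.factorial * Real.exp (-(c / 2 * ‖x‖ ^ 2)) *
            ((1 + C) * (1 + ‖x‖) ^ k') ^ l) := by
            gcongr
            · linarith
            · exact h1.trans (by gcongr)
        _ = l.factorial * (1 + C) ^ l * ((1 + ‖x‖) ^ (k + k' * l) *
            Real.exp (-(c / 2 * ‖x‖ ^ 2))) := by
            rw [mul_pow, pow_add, pow_mul]; ring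
        _ ≤ _ := by
            gcongr
            exact hA _ (norm_nonneg x) }

theorem gaussianSchwartz_apply {S : Matrix (Fin n) (Fin n) ℝ} (hS : S.PosDef) (x : Fin n → ℝ) :
    gaussianSchwartz hS x = (Real.exp (-(x ⬝ᵥ S *ᵥ x) / 2) : ℂ) := by
  rw [gaussianSchwartz, SchwartzMap.postcompCLM_apply]
  rfl

end Gaussian

end HarmonicChain

/-! ### Annihilation operators and the ground state -/

namespace HarmonicChain

open MeasureTheory Matrix
open scoped LineDeriv

variable {n : ℕ}

section Annihilation

/-- Multiplication of a Schwartz function by the coordinate `(S x) j`. -/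
noncomputable def mulCoord (S : Matrix (Fin n) (Fin n) ℝ) (j : Fin n) (φ : 𝓢(Fin n → ℝ, ℂ)) :
    𝓢(Fin n → ℝ, ℂ) :=
  SchwartzMap.smulLeftCLM ℂ (mulVecCLM S j) φ

theorem mulCoord_apply (S : Matrix (Fin n) (Fin n) ℝ) (j : Fin n) (φ : 𝓢(Fin n → ℝ, ℂ))
    (x : Fin n → ℝ) : mulCoord S j φ x = (S *ᵥ x) j * φ x := by
  rw [mulCoord, SchwartzMap.smulLeftCLM_apply_apply (mulVecCLM S j).hasTemperateGrowth,
    Complex.real_smul, mulVecCLM_apply]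

/-- The annihilation operator `∂ⱼ + (S x)ⱼ`. -/
noncomputable def annihilation (S : Matrix (Fin n) (Fin n) ℝ) (j : Fin n)
    (φ : 𝓢(Fin n → ℝ, ℂ)) : 𝓢(Fin n → ℝ, ℂ) :=
  ∂_{(Pi.single j 1 : Fin n → ℝ)} φ + mulCoord S j φ

theorem annihilation_apply (S : Matrix (Fin n) (Fin n) ℝ) (j : Fin n) (φ : 𝓢(Fin n → ℝ, ℂ))
    (x : Fin n → ℝ) :
    annihilation S j φ x = fderiv ℝ φ x (Pi.single j 1) + (S *ᵥ x) j * φ x := by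
  rw [annihilation, _root_.add_apply, mulCoord_apply]
  rfl

theorem lineDeriv_mulCoord (S : Matrix (Fin n) (Fin n) ℝ) (i j : Fin n) (φ : 𝓢(Fin n → ℝ, ℂ))
    (x : Fin n → ℝ) : fderiv ℝ (mulCoord S i φ) x (Pi.single j 1) =
      S i j * φ x + (S *ᵥ x) i * fderiv ℝ φ x (Pi.single j 1) := by
  have h1 : (mulCoord S i φ : (Fin n → ℝ) → ℂ) = fun x => mulVecCLM S i x • φ x := by
    ext x; rw [mulCoord_apply]; simp
  rw [h1, fderiv_fun_smul (mulVecCLM S i).differentiableAt φ.differentiableAt,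
    ContinuousLinearMap.fderiv]
  simp only [_root_.add_apply, _root_.smul_apply, ContinuousLinearMap.smulRight_apply,
    mulVecCLM_single, Complex.real_smul]
  rw [mulVecCLM_apply]
  ring

theorem hamiltonian_eq (V : Matrix (Fin n) (Fin n) ℝ) (φ : 𝓢(Fin n → ℝ, ℂ)) (x : Fin n → ℝ) :
    hamiltonian V φ x = (1 / 2 : ℂ) * ((x ⬝ᵥ V *ᵥ x : ℝ) * φ x) - (1 / 2 : ℂ) *
      ∑ j, (∂_{(Pi.single j 1 : Fin n → ℝ)} (∂_{(Pi.single j 1 : Fin n → ℝ)} φ)) x := by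
  have hpp : ∀ j k : Fin n, quadrature (Sum.inr j) (quadrature (Sum.inr k) φ) x =
      -(∂_{(Pi.single j 1 : Fin n → ℝ)} (∂_{(Pi.single k 1 : Fin n → ℝ)} φ)) x := by
    intro j k
    have h1 : quadrature (Sum.inr k) φ = fun y =>
        (-Complex.I) • (∂_{(Pi.single k 1 : Fin n → ℝ)} φ) y := rfl
    rw [h1]
    simp only [quadrature]
    rw [fderiv_fun_const_smul (SchwartzMap.differentiableAt _), _root_.smul_apply, smul_eq_mul,
      ← mul_assoc, ← SchwartzMap.lineDerivOp_apply_eq_fderiv]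
    linear_combination ((∂_{(Pi.single j 1 : Fin n → ℝ)} (∂_{(Pi.single k 1 : Fin n → ℝ)} φ)) x) *
      Complex.I_mul_I
  unfold hamiltonian
  rw [Fintype.sum_sum_type]
  simp only [Fintype.sum_sum_type, hamiltonianMatrix, fromBlocks_apply₁₁, fromBlocks_apply₁₂,
    fromBlocks_apply₂₁, fromBlocks_apply₂₂, Matrix.zero_apply, Complex.ofReal_zero, zero_mul,
    Finset.sum_const_zero, add_zero, zero_add, hpp, Matrix.smul_apply, smul_eq_mul, one_apply]
  rw [sub_eq_add_neg]
  congr 1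
  · simp only [quadrature, dotProduct, mulVec]
    push_cast
    simp only [Finset.mul_sum, Finset.sum_mul]
    exact Finset.sum_congr rfl fun i _ => Finset.sum_congr rfl fun j _ => by ring
  · rw [Finset.mul_sum, ← Finset.sum_neg_distrib]
    refine Finset.sum_congr rfl fun j _ => ?_
    rw [Finset.sum_eq_single j]
    · push_cast; simp
    · intro b _ hb; simp [hb.symm]
    · simp

/-- Completing the square: the adjoint of `∂ⱼ + (S x)ⱼ` is `(S x)ⱼ - ∂ⱼ`, and differentiating `(S
x)ⱼ` leaves `S j j`, which adds up to the zero-point energy `½ Tr S`. -/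
theorem hamiltonian_eq_annihilation {S V : Matrix (Fin n) (Fin n) ℝ} (hS : S.IsSymm)
    (hV : S * S = V) (φ : 𝓢(Fin n → ℝ, ℂ)) (x : Fin n → ℝ) :
    hamiltonian V φ x = (1 / 2 : ℂ) * ∑ j, ((S *ᵥ x) j * annihilation S j φ x -
      (∂_{(Pi.single j 1 : Fin n → ℝ)} (annihilation S j φ)) x) + (S.trace / 2 : ℝ) * φ x := by
  have h1 : ∀ j, (∂_{(Pi.single j 1 : Fin n → ℝ)} (annihilation S j φ)) x =
      (∂_{(Pi.single j 1 : Fin n → ℝ)} (∂_{(Pi.single j 1 : Fin n → ℝ)} φ)) x +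
        (S j j * φ x + (S *ᵥ x) j * fderiv ℝ φ x (Pi.single j 1)) := by
    intro j
    rw [annihilation, LineDeriv.lineDerivOp_add, _root_.add_apply,
      SchwartzMap.lineDerivOp_apply_eq_fderiv (f := mulCoord S j φ), lineDeriv_mulCoord]
  have h2 : x ⬝ᵥ V *ᵥ x = ∑ j, (S *ᵥ x) j ^ 2 := by
    rw [← hV, ← mulVec_mulVec, dotProduct_mulVec, ← mulVec_transpose, hS.eq, dotProduct]
    exact Finset.sum_congr rfl fun j _ => by ring
  rw [hamiltonian_eq, h2]
  simp only [h1, annihilation_apply, Matrix.trace, diag_apply]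
  push_cast
  have h3 : ∀ j, ((S *ᵥ x) j : ℂ) * (fderiv ℝ φ x (Pi.single j 1) + (S *ᵥ x) j * φ x) -
      ((∂_{(Pi.single j 1 : Fin n → ℝ)} (∂_{(Pi.single j 1 : Fin n → ℝ)} φ)) x +
        (S j j * φ x + (S *ᵥ x) j * fderiv ℝ φ x (Pi.single j 1))) =
      ((S *ᵥ x) j : ℂ) ^ 2 * φ x - (S j j : ℂ) * φ x -
        (∂_{(Pi.single j 1 : Fin n → ℝ)} (∂_{(Pi.single j 1 : Fin n → ℝ)} φ)) x := by
    intro j; ring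
  simp only [h3, Finset.sum_sub_distrib, ← Finset.sum_mul]
  ring

/-- The sesquilinear pairing `(z, w) ↦ conj z * w`. -/
noncomputable def conjMul : ℂ →L[ℝ] ℂ →L[ℝ] ℂ :=
  (ContinuousLinearMap.mul ℝ ℂ).comp (Complex.conjCLE : ℂ →L[ℝ] ℂ)

@[simp]
theorem conjMul_apply (z w : ℂ) : conjMul z w = conj z * w := rfl

theorem integrable_conj_mul (φ χ : 𝓢(Fin n → ℝ, ℂ)) :
    Integrable fun x => conj (φ x) * χ x :=
  (SchwartzMap.pairing conjMul φ χ).integrable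

theorem integral_conj_mul_adjoint (S : Matrix (Fin n) (Fin n) ℝ) (j : Fin n)
    (φ χ : 𝓢(Fin n → ℝ, ℂ)) :
    ∫ x, conj (φ x) * ((S *ᵥ x) j * χ x - (∂_{(Pi.single j 1 : Fin n → ℝ)} χ) x) =
      ∫ x, conj (annihilation S j φ x) * χ x := by
  have h1 := SchwartzMap.integral_bilinear_lineDerivOp_right_eq_neg_left (μ := volume) φ χ conjMul
    (Pi.single j 1 : Fin n → ℝ)
  simp only [conjMul_apply] at h1
  have h2 : ∀ x, conj (φ x) * ((S *ᵥ x) j * χ x - (∂_{(Pi.single j 1 : Fin n → ℝ)} χ) x) =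
      conj (mulCoord S j φ x) * χ x - conj (φ x) * (∂_{(Pi.single j 1 : Fin n → ℝ)} χ) x := by
    intro x
    rw [mulCoord_apply, map_mul, Complex.conj_ofReal]
    ring
  have h3 : ∀ x, conj (annihilation S j φ x) * χ x =
      conj (mulCoord S j φ x) * χ x + conj ((∂_{(Pi.single j 1 : Fin n → ℝ)} φ) x) * χ x := by
    intro x
    rw [annihilation, _root_.add_apply, map_add]
    ring
  simp only [h2, h3]
  rw [integral_sub (integrable_conj_mul _ _) (integrable_conj_mul _ _),
    integral_add (integrable_conj_mul _ _) (integrable_conj_mul _ _), h1, sub_neg_eq_add]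

theorem integral_conj_mul_self (φ : 𝓢(Fin n → ℝ, ℂ)) :
    ∫ x, conj (φ x) * φ x = ((∫ x, ‖φ x‖ ^ 2 : ℝ) : ℂ) := by
  rw [← integral_complex_ofReal]
  refine integral_congr_ae (Filter.Eventually.of_forall fun x => ?_)
  simp only
  rw [Complex.conj_mul', Complex.ofReal_pow]

theorem expectation_hamiltonian {S V : Matrix (Fin n) (Fin n) ℝ} (hS : S.IsSymm)
    (hV : S * S = V) (φ : 𝓢(Fin n → ℝ, ℂ)) :
    expectation φ (hamiltonian V) =
      (((∑ j, ∫ x, ‖annihilation S j φ x‖ ^ 2) / 2 + S.trace / 2 * ∫ x, ‖φ x‖ ^ 2 : ℝ) : ℂ) := by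
  have h1 : ∀ x, conj (φ x) * hamiltonian V φ x = (1 / 2 : ℂ) * ∑ j, conj (φ x) *
      ((mulCoord S j (annihilation S j φ) - ∂_{(Pi.single j 1 : Fin n → ℝ)} (annihilation S j φ)) x)
      + (S.trace / 2 : ℝ) * (conj (φ x) * φ x) := by
    intro x
    rw [hamiltonian_eq_annihilation hS hV, ← Finset.mul_sum]
    simp only [_root_.sub_apply, mulCoord_apply]
    ring
  have h2 : ∀ j, ∫ x, conj (φ x) * ((mulCoord S j (annihilation S j φ) -
      ∂_{(Pi.single j 1 : Fin n → ℝ)} (annihilation S j φ)) x) =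
      ((∫ x, ‖annihilation S j φ x‖ ^ 2 : ℝ) : ℂ) := by
    intro j
    rw [← integral_conj_mul_self, ← integral_conj_mul_adjoint]
    simp only [_root_.sub_apply, mulCoord_apply]
  unfold expectation
  simp only [h1]
  rw [integral_add ((integrable_finsetSum _ fun j _ => integrable_conj_mul _ _).const_mul _)
    ((integrable_conj_mul _ _).const_mul _), integral_const_mul, integral_const_mul,
    integral_finsetSum _ fun j _ => integrable_conj_mul _ _, integral_conj_mul_self]
  simp only [h2]
  push_cast
  ring

end Annihilation

section GroundState

theorem annihilation_gaussian {S : Matrix (Fin n) (Fin n) ℝ} (hS : S.PosDef) (hs : S.IsSymm)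
    (j : Fin n) : annihilation S j (gaussianSchwartz hS) = 0 := by
  ext x
  rw [annihilation_apply, gaussianSchwartz_apply, _root_.zero_apply]
  obtain ⟨D, hD, hDj⟩ := exists_hasFDerivAt_quadratic hs x
  have h1 : (gaussianSchwartz hS : (Fin n → ℝ) → ℂ) = fun x =>
      ((Real.exp (-(1 / 2) * (x ⬝ᵥ S *ᵥ x)) : ℝ) : ℂ) := by
    ext x; rw [gaussianSchwartz_apply]; congr 2; ring
  have h2 : HasFDerivAt (fun x : Fin n → ℝ =>
      ((Real.exp (-(1 / 2) * (x ⬝ᵥ S *ᵥ x)) : ℝ) : ℂ)) _ x :=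
    Complex.ofRealCLM.hasFDerivAt.comp x (hD.const_mul (-(1 / 2))).exp
  rw [h1, h2.fderiv]
  simp only [ContinuousLinearMap.comp_apply, _root_.smul_apply, hDj, smul_eq_mul,
    Complex.ofRealCLM_apply]
  rw [show -(x ⬝ᵥ S *ᵥ x) / 2 = -(1 / 2) * (x ⬝ᵥ S *ᵥ x) by ring]
  push_cast
  ring

theorem annihilation_smul (S : Matrix (Fin n) (Fin n) ℝ) (j : Fin n) (c : ℂ)
    (φ : 𝓢(Fin n → ℝ, ℂ)) : annihilation S j (c • φ) = c • annihilation S j φ := by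
  ext x
  have h1 : ((c • φ : 𝓢(Fin n → ℝ, ℂ)) : (Fin n → ℝ) → ℂ) = fun x => c • φ x := rfl
  rw [_root_.smul_apply (f := annihilation S j φ), annihilation_apply, annihilation_apply, h1,
    fderiv_fun_const_smul φ.differentiableAt]
  simp only [_root_.smul_apply, smul_eq_mul]
  ring

theorem isGroundState_of_annihilation_eq_zero {S V : Matrix (Fin n) (Fin n) ℝ} (hs : S.IsSymm)
    (hV : S * S = V) {ψ : 𝓢(Fin n → ℝ, ℂ)} (hψ : ∫ x, ‖ψ x‖ ^ 2 = 1)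
    (h : ∀ j, annihilation S j ψ = 0) : IsGroundState V ψ := by
  refine ⟨hψ, S.trace / 2, fun x => ?_, fun φ hφ => ?_⟩
  · rw [hamiltonian_eq_annihilation hs hV]
    simp [h, LineDeriv.lineDerivOp_zero]
  · rw [expectation_hamiltonian hs hV, Complex.ofReal_re, hφ, mul_one]
    have : 0 ≤ ∑ j, ∫ x, ‖annihilation S j φ x‖ ^ 2 :=
      Finset.sum_nonneg fun j _ => integral_nonneg fun x => sq_nonneg _
    linarith

theorem exists_normalized_annihilation_eq_zero {S : Matrix (Fin n) (Fin n) ℝ} (hS : S.PosDef)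
    (hs : S.IsSymm) : ∃ ψ : 𝓢(Fin n → ℝ, ℂ), ∫ x, ‖ψ x‖ ^ 2 = 1 ∧
      ∀ j, annihilation S j ψ = 0 := by
  set Z := ∫ x, ‖gaussianSchwartz hS x‖ ^ 2 with hZ
  have hsq : ∀ x, ‖gaussianSchwartz hS x‖ ^ 2 = Real.exp (2 * (-(x ⬝ᵥ S *ᵥ x) / 2)) := by
    intro x
    rw [gaussianSchwartz_apply, Complex.norm_real, Real.norm_of_nonneg (Real.exp_pos _).le,
      ← Real.exp_nat_mul]
    norm_num
  have hint : Integrable fun x => ‖gaussianSchwartz hS x‖ ^ 2 := by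
    have := (integrable_conj_mul (gaussianSchwartz hS) (gaussianSchwartz hS)).norm
    simpa [sq] using this
  have hZpos : 0 < Z := by
    rw [hZ]
    simp only [hsq] at hint ⊢
    exact integral_exp_pos hint
  refine ⟨((√Z)⁻¹ : ℂ) • gaussianSchwartz hS, ?_, fun j => ?_⟩
  · have h1 : ∀ x, ‖(((√Z)⁻¹ : ℂ) • gaussianSchwartz hS) x‖ ^ 2 =
        Z⁻¹ * ‖gaussianSchwartz hS x‖ ^ 2 := by
      intro x
      rw [_root_.smul_apply, norm_smul, mul_pow, norm_inv, Complex.norm_real,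
        Real.norm_of_nonneg (Real.sqrt_nonneg _), inv_pow, Real.sq_sqrt hZpos.le]
    simp only [h1]
    rw [integral_const_mul, ← hZ, inv_mul_cancel₀ hZpos.ne']
  · rw [annihilation_smul, annihilation_gaussian hS hs, smul_zero]

theorem exists_isGroundState {S V : Matrix (Fin n) (Fin n) ℝ} (hS : S.PosDef)
    (hs : S.IsSymm) (hV : S * S = V) : ∃ ψ : 𝓢(Fin n → ℝ, ℂ), IsGroundState V ψ := by
  obtain ⟨ψ, h1, h2⟩ := exists_normalized_annihilation_eq_zero hS hs
  exact ⟨ψ, isGroundState_of_annihilation_eq_zero hs hV h1 h2⟩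

/-- The Gaussian has energy `½ Tr S`, so minimality gives `E ≤ ½ Tr S`. But `E = ½ ∑ ‖aⱼ ψ‖² + ½ Tr
S`, so each `aⱼ ψ` vanishes almost everywhere, and everywhere by continuity. -/
theorem IsGroundState.annihilation_eq_zero {S V : Matrix (Fin n) (Fin n) ℝ} (hS : S.PosDef)
    (hs : S.IsSymm) (hV : S * S = V) {ψ : 𝓢(Fin n → ℝ, ℂ)} (hψ : IsGroundState V ψ) (j : Fin n) :
    annihilation S j ψ = 0 := by
  obtain ⟨hnorm, E, hE, hmin⟩ := hψ
  obtain ⟨φ, hφ1, hφ2⟩ := exists_normalized_annihilation_eq_zero hS hs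
  have h1 := hmin φ hφ1
  rw [expectation_hamiltonian hs hV, Complex.ofReal_re, hφ1] at h1
  simp only [hφ2, _root_.zero_apply, norm_zero, ne_eq, OfNat.ofNat_ne_zero, not_false_eq_true,
    zero_pow, integral_zero, Finset.sum_const_zero, zero_div, zero_add, mul_one] at h1
  have h2 : expectation ψ (hamiltonian V) = (E : ℂ) := by
    unfold expectation
    simp only [hE]
    have h3 : ∀ x, conj (ψ x) * (E * ψ x) = E * (conj (ψ x) * ψ x) := fun x => by ring
    simp only [h3]
    rw [integral_const_mul, integral_conj_mul_self, hnorm]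
    simp
  rw [expectation_hamiltonian hs hV, hnorm] at h2
  have h4 := Complex.ofReal_injective h2
  have hnn : ∀ i ∈ Finset.univ, 0 ≤ ∫ x, ‖annihilation S i ψ x‖ ^ 2 :=
    fun i _ => integral_nonneg fun x => sq_nonneg _
  have h5 : ∑ i, ∫ x, ‖annihilation S i ψ x‖ ^ 2 = 0 :=
    le_antisymm (by linarith) (Finset.sum_nonneg hnn)
  have h6 := (Finset.sum_eq_zero_iff_of_nonneg hnn).1 h5 j (Finset.mem_univ j)
  have hint : Integrable fun x => ‖annihilation S j ψ x‖ ^ 2 := by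
    have := (integrable_conj_mul (annihilation S j ψ) (annihilation S j ψ)).norm
    simpa [sq] using this
  rw [integral_eq_zero_iff_of_nonneg (fun x => sq_nonneg _) hint] at h6
  have h7 := (Continuous.ae_eq_iff_eq volume
    ((annihilation S j ψ).continuous.norm.pow 2) continuous_const).1 h6
  ext x
  have h8 : ‖annihilation S j ψ x‖ ^ 2 = 0 := congrFun h7 x
  simpa using h8

/-- The product `exp (⟨x, S x⟩ / 2) ψ` has zero derivative and is therefore constant. -/
theorem eq_gaussian_of_annihilation_eq_zero {S : Matrix (Fin n) (Fin n) ℝ} (hs : S.IsSymm)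
    {ψ : 𝓢(Fin n → ℝ, ℂ)} (h : ∀ j, annihilation S j ψ = 0) (x : Fin n → ℝ) :
    ψ x = (Real.exp (-(x ⬝ᵥ S *ᵥ x) / 2) : ℂ) * ψ 0 := by
  let F : (Fin n → ℝ) → ℂ := fun x => Real.exp (1 / 2 * (x ⬝ᵥ S *ᵥ x)) • ψ x
  have hF : ∀ x, HasFDerivAt F (0 : (Fin n → ℝ) →L[ℝ] ℂ) x := by
    intro x
    obtain ⟨D, hD, hDj⟩ := exists_hasFDerivAt_quadratic hs x
    have hψ : HasFDerivAt ψ (fderiv ℝ ψ x) x := ψ.differentiableAt.hasFDerivAt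
    have h1 := ((hD.const_mul (1 / 2)).exp).smul hψ
    refine h1.congr_fderiv ?_
    have h2 : ∀ j, fderiv ℝ ψ x (Pi.single j 1) = -((S *ᵥ x) j * ψ x) := by
      intro j
      have := congrArg (fun φ : 𝓢(Fin n → ℝ, ℂ) => φ x) (h j)
      simp only [annihilation_apply, _root_.zero_apply] at this
      linear_combination this
    apply ContinuousLinearMap.coe_injective
    apply LinearMap.pi_ext'
    intro j
    apply LinearMap.ext_ring
    simp only [LinearMap.comp_apply, LinearMap.single_apply, ContinuousLinearMap.coe_coe,
      _root_.add_apply, _root_.smul_apply, ContinuousLinearMap.smulRight_apply, hDj, h2,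
      _root_.zero_apply, Complex.real_smul, smul_eq_mul]
    push_cast
    ring
  have hconst : F x = F 0 := is_const_of_fderiv_eq_zero (𝕜 := ℝ) (fun x => (hF x).differentiableAt)
    (fun x => (hF x).fderiv) x 0
  have h0 : F 0 = ψ 0 := by simp [F]
  rw [← h0, ← hconst]
  simp only [F, Complex.real_smul]
  rw [← mul_assoc, ← Complex.ofReal_mul, ← Real.exp_add]
  rw [show -(x ⬝ᵥ S *ᵥ x) / 2 + 1 / 2 * (x ⬝ᵥ S *ᵥ x) = 0 by ring]
  simp

end GroundState

end HarmonicChain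

/-! ### The covariance matrix of the ground state -/

namespace HarmonicChain

open MeasureTheory Matrix
open scoped LineDeriv

section Covariance

variable {n : ℕ} {S : Matrix (Fin n) (Fin n) ℝ} {ψ : 𝓢(Fin n → ℝ, ℂ)}

theorem fderiv_of_annihilation_eq_zero (h : ∀ j, annihilation S j ψ = 0) (j : Fin n)
    (x : Fin n → ℝ) : fderiv ℝ ψ x (Pi.single j 1) = -((S *ᵥ x) j * ψ x) := by
  have := congrArg (fun φ : 𝓢(Fin n → ℝ, ℂ) => φ x) (h j)
  simp only [annihilation_apply, _root_.zero_apply] at this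
  linear_combination this

/-- Pair `aⱼ ψ = 0` with `(A x)ₖ ψ` and move `aⱼ` to the other side. The case `A = 1` gives the
position moments, `A = S` the momentum moments. -/
theorem integral_mulCoord_mulCoord (hnorm : ∫ x, ‖ψ x‖ ^ 2 = 1)
    (h : ∀ j, annihilation S j ψ = 0) (A : Matrix (Fin n) (Fin n) ℝ) (j k : Fin n) :
    ∫ x, conj (ψ x) * ((S *ᵥ x) j * ((A *ᵥ x) k * ψ x)) = (A k j / 2 : ℝ) := by
  have h1 := integral_conj_mul_adjoint S j ψ (mulCoord A k ψ)
  have h2 : ∀ x, conj (ψ x) * ((S *ᵥ x) j * mulCoord A k ψ x -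
      (∂_{(Pi.single j 1 : Fin n → ℝ)} (mulCoord A k ψ)) x) =
      2 * (conj (ψ x) * mulCoord S j (mulCoord A k ψ) x) - A k j * (conj (ψ x) * ψ x) := by
    intro x
    rw [SchwartzMap.lineDerivOp_apply_eq_fderiv, lineDeriv_mulCoord,
      fderiv_of_annihilation_eq_zero h, mulCoord_apply, mulCoord_apply, mulCoord_apply]
    ring
  simp only [h2, h, _root_.zero_apply, map_zero, zero_mul, integral_zero] at h1
  rw [integral_sub ((integrable_conj_mul _ _).const_mul _) ((integrable_conj_mul _ _).const_mul _),
    integral_const_mul, integral_const_mul, integral_conj_mul_self, hnorm] at h1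
  simp only [mulCoord_apply] at h1
  push_cast at h1 ⊢
  linear_combination h1 / 2

theorem expectation_quadrature_eq_zero (hs : S.IsSymm) (h : ∀ j, annihilation S j ψ = 0)
    (k : Fin n ⊕ Fin n) : expectation ψ (quadrature k) = 0 := by
  have heven : ∀ x, ψ (-x) = ψ x := by
    intro x
    rw [eq_gaussian_of_annihilation_eq_zero hs h, eq_gaussian_of_annihilation_eq_zero hs h x]
    simp [mulVec_neg]
  have hodd : ∀ f : (Fin n → ℝ) → ℂ, (∀ x, f (-x) = -f x) → ∫ x, f x = 0 := by
    intro f hf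
    have h1 := integral_neg_eq_self f volume
    simp only [hf] at h1
    rw [integral_neg] at h1
    linear_combination -h1 / 2
  unfold expectation
  apply hodd
  intro x
  rcases k with j | j
  · simp only [quadrature, heven, Pi.neg_apply]
    push_cast; ring
  · simp only [quadrature, fderiv_of_annihilation_eq_zero h, heven, mulVec_neg, Pi.neg_apply]
    push_cast; ring

theorem covarianceMatrix_eq (hs : S.IsSymm) (hnorm : ∫ x, ‖ψ x‖ ^ 2 = 1)
    (h : ∀ j, annihilation S j ψ = 0) :
    covarianceMatrix ψ = fromBlocks ((1 / 2 : ℝ) • S⁻¹) 0 0 ((1 / 2 : ℝ) • S) := by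
  have hcov : ∀ k l, covarianceMatrix ψ k l =
      (∫ x, conj (ψ x) * quadrature k (quadrature l ψ) x).re := by
    intro k l
    have hc : ∀ k φ, centeredQuadrature ψ k φ = quadrature k φ := by
      intro k φ
      ext x
      simp [centeredQuadrature, expectation_quadrature_eq_zero hs h]
    rw [covarianceMatrix, of_apply, expectation]
    simp only [hc]
  have hreal : ∀ (f : (Fin n → ℝ) → ℂ) (c : ℂ) (g : (Fin n → ℝ) → ℝ), (∀ x, f x = c * g x) →
      ∫ x, f x = c * (∫ x, g x : ℝ) := by
    intro f c g hf
    simp only [hf]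
    rw [integral_const_mul, integral_complex_ofReal]
  have hqp : ∀ k, quadrature (Sum.inr k) ψ = fun x => Complex.I • mulCoord S k ψ x := by
    intro k
    ext x
    simp only [quadrature, fderiv_of_annihilation_eq_zero h, mulCoord_apply, smul_eq_mul]
    ring
  have hconj : ∀ x, conj (ψ x) * ψ x = ((‖ψ x‖ ^ 2 : ℝ) : ℂ) := by
    intro x; rw [Complex.conj_mul', Complex.ofReal_pow]
  have hqx : ∀ k, quadrature (Sum.inl k) ψ = mulCoord 1 k ψ := by
    intro k
    ext x
    simp [quadrature, mulCoord_apply]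
  ext (j | j) (k | k)
  · rw [hcov, fromBlocks_apply₁₁]
    set Mom : Matrix (Fin n) (Fin n) ℝ := of fun j k => ∫ x : Fin n → ℝ, x j * x k * ‖ψ x‖ ^ 2
      with hMom
    have hint : ∀ j k, Integrable fun x : Fin n → ℝ => x j * x k * ‖ψ x‖ ^ 2 := by
      intro j k
      have h1 := (integrable_conj_mul ψ (mulCoord 1 j (mulCoord 1 k ψ))).re
      refine h1.congr (Filter.Eventually.of_forall fun x => ?_)
      have h2 : conj (ψ x) * mulCoord 1 j (mulCoord 1 k ψ) x =
          ((x j * x k * ‖ψ x‖ ^ 2 : ℝ) : ℂ) := by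
        rw [mulCoord_apply, mulCoord_apply, one_mulVec, Complex.ofReal_mul, ← hconj]
        push_cast
        ring
      simp only [h2]
      exact Complex.ofReal_re _
    -- This identifies the position moments with `½ S⁻¹` without evaluating any Gaussian integral.
    have hSM : S * Mom = (1 / 2 : ℝ) • (1 : Matrix (Fin n) (Fin n) ℝ) := by
      ext j k
      have h1 := integral_mulCoord_mulCoord hnorm h 1 j k
      rw [hreal _ 1 (fun x => (S *ᵥ x) j * x k * ‖ψ x‖ ^ 2) (fun x => by
        rw [Complex.ofReal_mul, ← hconj, one_mulVec]; push_cast; ring), one_mul] at h1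
      have h2 := Complex.ofReal_injective h1
      rw [mul_apply, Matrix.smul_apply, smul_eq_mul, one_div, inv_mul_eq_div, one_apply]
      rw [one_apply] at h2
      rw [show (if j = k then (1 : ℝ) else 0) = if k = j then 1 else 0 by simp only [eq_comm], ← h2]
      have h3 : ∀ x : Fin n → ℝ, (S *ᵥ x) j * x k * ‖ψ x‖ ^ 2 =
          ∑ i, S j i * (x i * x k * ‖ψ x‖ ^ 2) := by
        intro x
        simp only [mulVec, dotProduct, Finset.sum_mul]
        exact Finset.sum_congr rfl fun i _ => by ring
      simp only [h3]
      rw [integral_finsetSum _ fun i _ => (hint i k).const_mul _]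
      simp only [integral_const_mul, hMom, of_apply]
    have hinv : S⁻¹ = (2 : ℝ) • Mom := by
      apply inv_eq_right_inv
      rw [Matrix.mul_smul, hSM, smul_smul]
      norm_num
    rw [hinv, smul_smul, hreal _ 1 (fun x => x j * x k * ‖ψ x‖ ^ 2) (fun x => by
      rw [Complex.ofReal_mul, ← hconj]
      simp only [quadrature]
      push_cast; ring), one_mul, Complex.ofReal_re]
    norm_num [hMom]
  -- Mixed position and momentum moments are `±i` times a real integral, so the real part is zero.
  · rw [hcov, fromBlocks_apply₁₂, hqp, hreal _ Complex.I (fun x => x j * (S *ᵥ x) k * ‖ψ x‖ ^ 2)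
      (fun x => by
        rw [Complex.ofReal_mul, ← hconj]
        simp only [quadrature, mulCoord_apply, smul_eq_mul]
        push_cast; ring)]
    simp
  · rw [hcov, fromBlocks_apply₂₁, hqx, hreal _ (-Complex.I)
      (fun x => ((1 : Matrix (Fin n) (Fin n) ℝ) k j - x k * (S *ᵥ x) j) * ‖ψ x‖ ^ 2) (fun x => by
        rw [Complex.ofReal_mul, ← hconj]
        simp only [quadrature]
        rw [lineDeriv_mulCoord, fderiv_of_annihilation_eq_zero h, one_mulVec]
        push_cast; ring)]
    simp
  · rw [hcov, fromBlocks_apply₂₂, hqp]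
    have h1 : ∀ x, conj (ψ x) * quadrature (Sum.inr j)
        (fun x => Complex.I • mulCoord S k ψ x) x =
        S k j * (conj (ψ x) * ψ x) - conj (ψ x) * mulCoord S j (mulCoord S k ψ) x := by
      intro x
      simp only [quadrature]
      rw [fderiv_fun_const_smul (mulCoord S k ψ).differentiableAt, _root_.smul_apply,
        lineDeriv_mulCoord, fderiv_of_annihilation_eq_zero h, mulCoord_apply, mulCoord_apply,
        smul_eq_mul]
      linear_combination -(conj (ψ x) * (S k j * ψ x - (S *ᵥ x) k * ((S *ᵥ x) j * ψ x))) *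
        Complex.I_mul_I
    simp only [h1]
    rw [integral_sub ((integrable_conj_mul _ _).const_mul _) (integrable_conj_mul _ _),
      integral_const_mul, integral_conj_mul_self, hnorm]
    simp only [mulCoord_apply]
    rw [integral_mulCoord_mulCoord hnorm h, ← Complex.ofReal_mul, ← Complex.ofReal_sub,
      Complex.ofReal_re, Matrix.smul_apply, hs.apply, smul_eq_mul]
    ring

end Covariance

end HarmonicChain

/-! ### The partial transpose and its trace norm -/

namespace HarmonicChain

open MeasureTheory Matrix

section PartialTranspose

variable {m : ℕ}

theorem glue_eq (x y : Fin (m + m) → ℝ) :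
    glue x y = (1 / 2 : ℝ) • (x + y) + (1 / 2 : ℝ) • (halfSign m *ᵥ (x - y)) := by
  ext i
  simp only [glue, halfSign, mulVec_diagonal, Pi.add_apply, Pi.smul_apply, Pi.sub_apply,
    smul_eq_mul]
  split_ifs <;> ring

theorem glue_swap_eq (x y : Fin (m + m) → ℝ) :
    glue y x = (1 / 2 : ℝ) • (x + y) - (1 / 2 : ℝ) • (halfSign m *ᵥ (x - y)) := by
  rw [glue_eq y x, add_comm y x, ← neg_sub x y, mulVec_neg, smul_neg, ← sub_eq_add_neg]

theorem quadratic_eq_sum {n : ℕ} {A M : Matrix (Fin n) (Fin n) ℝ} (hM : M.det ≠ 0) {s : Fin n → ℝ}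
    (hA : Mᵀ * A * M = diagonal s) (x : Fin n → ℝ) :
    x ⬝ᵥ A *ᵥ x = ∑ j, s j * (M⁻¹ *ᵥ x) j ^ 2 := by
  have h1 : x = M *ᵥ (M⁻¹ *ᵥ x) := by
    rw [mulVec_mulVec, mul_nonsing_inv M (isUnit_iff_ne_zero.2 hM), one_mulVec]
  have h2 : ∀ u, (M *ᵥ u) ⬝ᵥ A *ᵥ (M *ᵥ u) = ∑ j, s j * u j ^ 2 := by
    intro u
    rw [mulVec_mulVec, dotProduct_comm, dotProduct_mulVec, ← mulVec_transpose, mulVec_mulVec,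
      ← Matrix.mul_assoc, hA, dotProduct]
    exact Finset.sum_congr rfl fun j _ => by rw [mulVec_diagonal]; ring
  rw [← h2, ← h1]

/-- The parallelogram law: the two glued points are a midpoint plus or minus a reflected half
difference, so the cross terms cancel and the reflected matrix appears. -/
theorem quadratic_glue (S : Matrix (Fin (m + m)) (Fin (m + m)) ℝ) (x y : Fin (m + m) → ℝ) :
    glue x y ⬝ᵥ S *ᵥ glue x y + glue y x ⬝ᵥ S *ᵥ glue y x =
      ((x + y) ⬝ᵥ S *ᵥ (x + y) +
        (x - y) ⬝ᵥ (halfSign m * S * halfSign m) *ᵥ (x - y)) / 2 := by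
  have h1 : (x - y) ⬝ᵥ (halfSign m * S * halfSign m) *ᵥ (x - y) =
      (halfSign m *ᵥ (x - y)) ⬝ᵥ S *ᵥ (halfSign m *ᵥ (x - y)) := by
    have hT : (halfSign m)ᵀ = halfSign m := diagonal_transpose _
    rw [← mulVec_mulVec, ← mulVec_mulVec, dotProduct_mulVec, ← mulVec_transpose, hT]
  rw [glue_swap_eq, glue_eq, h1]
  simp only [mulVec_add, mulVec_sub, mulVec_smul, add_dotProduct, sub_dotProduct, dotProduct_add,
    dotProduct_sub, smul_dotProduct, dotProduct_smul, smul_eq_mul]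
  ring

variable {S M : Matrix (Fin (m + m)) (Fin (m + m)) ℝ} {s t : Fin (m + m) → ℝ}
  {ψ : 𝓢(Fin (m + m) → ℝ, ℂ)}

/-- From `s (u + v)² + t (u - v)² = (s + t)(u² + v²) + 2 (s - t) u v` in the coordinates `u = M⁻¹
x`, `v = M⁻¹ y`. -/
theorem partialTranspose_densityKernel_eq (hM : M.det ≠ 0)
    (hS : Mᵀ * S * M = diagonal s)
    (hS' : Mᵀ * (halfSign m * S * halfSign m) * M = diagonal t)
    (hψ : ∀ x, ψ x = (Real.exp (-(x ⬝ᵥ S *ᵥ x) / 2) : ℂ) * ψ 0) (x y : Fin (m + m) → ℝ) :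
    partialTranspose (densityKernel ψ) x y =
      ((‖ψ 0‖ ^ 2 * Real.exp (-(∑ j, (s j + t j) / 2 * (M⁻¹ *ᵥ x) j ^ 2) / 2 -
        (∑ j, (s j + t j) / 2 * (M⁻¹ *ᵥ y) j ^ 2) / 2 -
        ∑ j, (s j - t j) / 2 * (M⁻¹ *ᵥ x) j * (M⁻¹ *ᵥ y) j) : ℝ) : ℂ) := by
  have h1 := quadratic_glue S x y
  rw [quadratic_eq_sum hM hS (x + y), quadratic_eq_sum hM hS', ← Finset.sum_add_distrib] at h1
  have h2 : -(∑ j, (s j + t j) / 2 * (M⁻¹ *ᵥ x) j ^ 2) / 2 -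
      (∑ j, (s j + t j) / 2 * (M⁻¹ *ᵥ y) j ^ 2) / 2 -
      ∑ j, (s j - t j) / 2 * (M⁻¹ *ᵥ x) j * (M⁻¹ *ᵥ y) j =
      -(glue x y ⬝ᵥ S *ᵥ glue x y) / 2 + -(glue y x ⬝ᵥ S *ᵥ glue y x) / 2 := by
    have h3 : ∑ j, (s j * (M⁻¹ *ᵥ (x + y)) j ^ 2 + t j * (M⁻¹ *ᵥ (x - y)) j ^ 2) =
        2 * ∑ j, (s j + t j) / 2 * (M⁻¹ *ᵥ x) j ^ 2 +
        2 * ∑ j, (s j + t j) / 2 * (M⁻¹ *ᵥ y) j ^ 2 +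
        4 * ∑ j, (s j - t j) / 2 * (M⁻¹ *ᵥ x) j * (M⁻¹ *ᵥ y) j := by
      rw [Finset.mul_sum, Finset.mul_sum, Finset.mul_sum, ← Finset.sum_add_distrib,
        ← Finset.sum_add_distrib]
      refine Finset.sum_congr rfl fun j _ => ?_
      rw [mulVec_add, mulVec_sub, Pi.add_apply, Pi.sub_apply]
      ring
    rw [h3] at h1
    linear_combination h1 / 2
  rw [h2, Real.exp_add]
  simp only [partialTranspose, densityKernel]
  rw [hψ (glue x y), hψ (glue y x), map_mul, Complex.conj_ofReal]
  have h4 := Complex.mul_conj' (ψ 0)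
  push_cast at h4 ⊢
  linear_combination (Complex.exp (-((glue x y ⬝ᵥ S *ᵥ glue x y : ℝ) : ℂ) / 2) *
    Complex.exp (-((glue y x ⬝ᵥ S *ᵥ glue y x : ℝ) : ℂ) / 2)) * h4

/-- The Mehler formula applies with `d - |b| = min (s, t)`. Normalization of `ψ` is the same
Gaussian integral with exponents `s`, so `|ψ 0|²`, `det M` and `π` drop out of the quotient. -/
theorem traceNorm_partialTranspose (hM : M.det ≠ 0) (hs : ∀ i, 0 < s i) (ht : ∀ i, 0 < t i)
    (hS : Mᵀ * S * M = diagonal s)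
    (hS' : Mᵀ * (halfSign m * S * halfSign m) * M = diagonal t)
    (hnorm : ∫ x, ‖ψ x‖ ^ 2 = 1)
    (hψ : ∀ x, ψ x = (Real.exp (-(x ⬝ᵥ S *ᵥ x) / 2) : ℂ) * ψ 0) :
    traceNorm (partialTranspose (densityKernel ψ)) =
      ENNReal.ofReal (∏ j, √(s j / min (s j) (t j))) := by
  have hL : (M⁻¹).det ≠ 0 := by
    rw [det_nonsing_inv, Ring.inverse_eq_inv']; exact inv_ne_zero hM
  have hmin : ∀ j, (s j + t j) / 2 - |(s j - t j) / 2| = min (s j) (t j) := by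
    intro j
    rcases le_total (s j) (t j) with h | h
    · rw [min_eq_left h, abs_of_nonpos (by linarith)]; ring
    · rw [min_eq_right h, abs_of_nonneg (by linarith)]; ring
  have hpos : ∀ j, 0 < min (s j) (t j) := fun j => lt_min (hs j) (ht j)
  have hker : partialTranspose (densityKernel ψ) = fun x y =>
      ((‖ψ 0‖ ^ 2 * Real.exp (-(∑ j, (s j + t j) / 2 * (M⁻¹ *ᵥ x) j ^ 2) / 2 -
        (∑ j, (s j + t j) / 2 * (M⁻¹ *ᵥ y) j ^ 2) / 2 -
        ∑ j, (s j - t j) / 2 * (M⁻¹ *ᵥ x) j * (M⁻¹ *ᵥ y) j) : ℝ) : ℂ) := by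
    ext x y
    exact partialTranspose_densityKernel_eq hM hS hS' hψ x y
  rw [hker, traceNorm_mehler hL (sq_nonneg _) (d := fun j => (s j + t j) / 2)
    (b := fun j => (s j - t j) / 2) fun j => by
      have := hmin j
      have := hpos j
      linarith]
  simp only [hmin]
  congr 1
  have h1 : ‖ψ 0‖ ^ 2 * (|(M⁻¹).det⁻¹| * ∏ j, √(Real.pi / s j)) = 1 := by
    rw [← (integrable_integral_gaussian hL hs).2, ← hnorm, ← integral_const_mul]
    congr 1
    ext x
    rw [hψ x, norm_mul, Complex.norm_real, Real.norm_of_nonneg (Real.exp_pos _).le, mul_pow,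
      ← Real.exp_nat_mul, quadratic_eq_sum hM hS, mul_comm]
    congr 2
    push_cast
    ring
  have h2 : ∏ j, √(Real.pi / min (s j) (t j)) =
      (∏ j, √(Real.pi / s j)) * ∏ j, √(s j / min (s j) (t j)) := by
    rw [← Finset.prod_mul_distrib]
    refine Finset.prod_congr rfl fun j _ => ?_
    rw [← Real.sqrt_mul (div_pos Real.pi_pos (hs j)).le]
    congr 1
    have := (hs j).ne'
    have := (hpos j).ne'
    field_simp
  rw [h2]
  linear_combination (∏ j, √(s j / min (s j) (t j))) * h1

theorem two_mul_logb_prod_sqrt {ι : Type*} [Fintype ι] {s t : ι → ℝ} (hs : ∀ i, 0 < s i)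
    (ht : ∀ i, 0 < t i) :
    2 * Real.logb 2 (∏ j, √(s j / min (s j) (t j))) = ∑ j, max 0 (Real.logb 2 (s j / t j)) := by
  have hpos : ∀ j, 0 < s j / min (s j) (t j) := fun j => div_pos (hs j) (lt_min (hs j) (ht j))
  rw [Real.logb_prod _ _ fun j _ => (Real.sqrt_pos.2 (hpos j)).ne', Finset.mul_sum]
  refine Finset.sum_congr rfl fun j _ => ?_
  have h1 : 2 * Real.logb 2 √(s j / min (s j) (t j)) = Real.logb 2 (s j / min (s j) (t j)) := by
    rw [Real.logb, Real.log_sqrt (hpos j).le, Real.logb]; ring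
  rw [h1]
  rcases le_total (s j) (t j) with h | h
  · rw [min_eq_left h, div_self (hs j).ne', Real.logb_one, max_eq_left]
    exact Real.logb_nonpos one_lt_two (div_pos (hs j) (ht j)).le ((div_le_one (ht j)).2 h)
  · rw [min_eq_right h, max_eq_right]
    exact Real.logb_nonneg one_lt_two ((one_le_div (ht j)).2 h)

end PartialTranspose

end HarmonicChain

/-! ### The main theorem -/

theorem theorem1 (m : ℕ) (V : Matrix (Fin (m + m)) (Fin (m + m)) ℝ)
    (hcirc : HarmonicChain.IsCirculant V) (hsymm : V.IsSymm) (hpos : V.PosDef) :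
    (∃ ψ : SchwartzMap (Fin (m + m) → ℝ) ℂ, HarmonicChain.IsGroundState V ψ) ∧
    ∀ ψ : SchwartzMap (Fin (m + m) → ℝ) ℂ, HarmonicChain.IsGroundState V ψ →
      ∀ (T : ENNReal) (N : ℝ),
      T = HarmonicChain.traceNorm
        (HarmonicChain.partialTranspose (HarmonicChain.densityKernel ψ)) →
      N = HarmonicChain.negativitySum (HarmonicChain.covarianceMatrix ψ) →
      (T ≠ ⊤ ∧ N = 2 * Real.logb 2 T.toReal) ∧
      |(HarmonicChain.flip (m + m) * HarmonicChain.matrixLog2 V).trace| / 2 ≤ N ∧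
      (HarmonicChain.IsSemidefinite (HarmonicChain.offDiagBlock V * HarmonicChain.flip m) →
        N = |(HarmonicChain.flip (m + m) * HarmonicChain.matrixLog2 V).trace| / 2) ∧
      (HarmonicChain.IsNearestNeighbour V →
        HarmonicChain.IsSemidefinite (HarmonicChain.offDiagBlock V * HarmonicChain.flip m) ∧
        N = |(HarmonicChain.flip (m + m) * HarmonicChain.matrixLog2 V).trace| / 2) := by
  obtain ⟨S, M, s, t, ν, hS, hSV, hM, hs, ht, hMS, hMS', hν, hsum, htrace, hsemi⟩ :=
    HarmonicChain.exists_normalForm hcirc hsymm hpos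
  have hSsymm : S.IsSymm := by
    have := hS.1
    rwa [Matrix.IsHermitian, Matrix.conjTranspose_eq_transpose_of_trivial] at this
  refine ⟨HarmonicChain.exists_isGroundState hS hSsymm hSV, ?_⟩
  intro ψ hψ T N hT hN
  have hann := hψ.annihilation_eq_zero hS hSsymm hSV
  have hgauss := HarmonicChain.eq_gaussian_of_annihilation_eq_zero hSsymm hann
  rw [HarmonicChain.traceNorm_partialTranspose hM hs ht hMS hMS' hψ.1 hgauss] at hT
  rw [HarmonicChain.covarianceMatrix_eq hSsymm hψ.1 hann,
    HarmonicChain.negativitySum_eq hM hs ht hMS hMS'] at hN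
  -- The pairs `(1, ν)` and `(ν, 1)` contribute the negative and the positive part of `log₂ ν`.
  have hNabs : N = ∑ j, |Real.logb 2 (ν j)| := by
    rw [hN, hsum fun a b => max 0 (Real.logb 2 (a / b)), ← Finset.sum_add_distrib]
    refine Finset.sum_congr rfl fun j _ => ?_
    rw [div_one, one_div, Real.logb_inv]
    rcases le_total 0 (Real.logb 2 (ν j)) with h | h
    · rw [max_eq_left (by linarith), max_eq_right h, abs_of_nonneg h, zero_add]
    · rw [max_eq_right (by linarith), max_eq_left h, abs_of_nonpos h, add_zero]
  have htr : |(HarmonicChain.flip (m + m) * HarmonicChain.matrixLog2 V).trace| / 2 =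
      |∑ j, Real.logb 2 (ν j)| := by
    rw [htrace, abs_neg, abs_mul, abs_two]; ring
  have heq : HarmonicChain.IsSemidefinite
      (HarmonicChain.offDiagBlock V * HarmonicChain.flip m) →
      N = |(HarmonicChain.flip (m + m) * HarmonicChain.matrixLog2 V).trace| / 2 := by
    intro h
    rw [htr, hNabs]
    rcases hsemi h with h1 | h1
    · have h2 : ∀ j, Real.logb 2 (ν j) ≤ 0 := fun j =>
        Real.logb_nonpos one_lt_two (hν j).le (h1 j)
      rw [abs_of_nonpos (Finset.sum_nonpos fun j _ => h2 j), ← Finset.sum_neg_distrib]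
      exact Finset.sum_congr rfl fun j _ => abs_of_nonpos (h2 j)
    · have h2 : ∀ j, 0 ≤ Real.logb 2 (ν j) := fun j => Real.logb_nonneg one_lt_two (h1 j)
      rw [abs_of_nonneg (Finset.sum_nonneg fun j _ => h2 j)]
      exact Finset.sum_congr rfl fun j _ => abs_of_nonneg (h2 j)
  refine ⟨⟨?_, ?_⟩, ?_, heq, fun h => ?_⟩
  · rw [hT]; exact ENNReal.ofReal_ne_top
  · rw [hT, ENNReal.toReal_ofReal (Finset.prod_nonneg fun j _ => Real.sqrt_nonneg _),
      HarmonicChain.two_mul_logb_prod_sqrt hs ht, hN]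
  · rw [htr, hNabs]
    exact Finset.abs_sum_le_sum_abs _ _
  · have h1 := HarmonicChain.isSemidefinite_of_isNearestNeighbour hcirc hsymm h
    exact ⟨h1, heq h1⟩
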